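/- **Conventions.** A simplicial complex is a family of nonempty finite subsets of a vertex set that is closed under passing to nonempty subsets (it may be infinite, and it may have no simplices); $|K|$ is its geometric realization with the weak topology; it is *pure* if all its maximal simplices have the same dimension. The order complex $\Delta P$ of a poset $P$ consists of the nonempty finite chains of $P$. $\Sigma Y$ is the (unreduced) suspension of $Y$, obtained from $Y\times[0,1]\sqcup\{\text{south},\text{north}\}$ by collapsing $Y\times\{0\}$ to the south pole and $Y\times\{1\}$ to the north pole; thus $\Sigma\emptyset=S^0$ and $\Sigma^2\emptyset\cong S^1$. For $A\subset Y$ the quotient $Y/A$ is $Y\sqcup\{*\}$ with $A$ glued to $*$, so $Y/\emptyset=Y\sqcup\{*\}$. The symbol $\simeq$ means homotopy equivalent. For a metric space $X$, $a,b\in X$ and $\ell\ge 0$, let $$\mathrm{Cau}^\ell(X;a,b)=\{(x,t)\in X\times[0,\ell] : d(a,x)\le t,\ d(x,b)\le \ell-t\},$$ ordered by $(x,t)\le(x',t')\iff d(x,x')\le t'-t$. Let $\dot\Delta\mathrm{Cau}^\ell(X;a,b)$ be the subcomplex of $\Delta\mathrm{Cau}^\ell(X;a,b)$ consisting of the chains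 $(x_0,t_0)<\dots<(x_n,t_n)$ with $\sum_{i=1}^n d(x_{i-1},x_i)<\ell$. The *magnitude homotopy type* is $$\mathcal M^\ell(X;a,b)=|\Delta\mathrm{Cau}^\ell(X;a,b)|\,/\,|\dot\Delta\mathrm{Cau}^\ell(X;a,b)|.$$ Let $I(a,b)=\{x\in X\setminus\{a,b\} : d(a,x)+d(x,b)=d(a,b)\}$, ordered by $x\le y\iff d(a,x)+d(x,y)+d(y,b)=d(a,b)$. A *weighted graph* is a graph with a positive length for every edge. If it is connected and its edge lengths are bounded below by a positive constant, it is regarded as the metric space of its vertices, the distance of two vertices being the infimum of the lengths of the paths connecting them. An ordinary graph is a weighted graph with all edge lengths equal to $1$. **Statement.** (i) Let $X$ be a metric space and let $a,b\in X$ with $a\ne b$. Then $\mathcal M^{d(a,b)}(X;a,b)\simeq\Sigma^2|\Delta I(a,b)|$. (ii) Let $Z$ be a finite-dimensional simplicial complex. Then there exist a connected weighted graph $G$ with edge lengths bounded below by a positive constant, vertices $a,b$ of $G$, and a real number $\ell\ge 0$ such that $\Sigma^2|Z|\simeq\mathcal M^\ell(G;a,b)$. (iii) Let $Z$ be a finite-dimensional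 pure simplicial complex. Then there exist a connected ordinary graph $G$, vertices $a,b$ of $G$, and a real number $\ell\ge 0$ such that $\Sigma^2|Z|\simeq\mathcal M^\ell(G;a,b)$. If $Z$ is finite, then $G$ can be taken to be finite. -/

import Mathlib

open scoped unitInterval ContinuousMap

universe u v

noncomputable section

/-! ### Simplicial complexes and their geometric realizations

An abstract simplicial complex with vertices in `V` is a `PreAbstractSimplicialComplex V`: a family
of nonempty finite subsets of `V` closed under passing to nonempty subsets. -/

namespace PreAbstractSimplicialComplex

variable {V : Type u}

/-- The geometric realization `|K|` in barycentric coordinates: finitely supported functions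
`V → [0, ∞)` with sum `1` whose support is a simplex of `K`. -/
def Realization (K : PreAbstractSimplicialComplex V) : Type u :=
  {f : V →₀ ℝ // (∀ x, 0 ≤ f x) ∧ f.support ∈ K.faces ∧ (f.sum fun _ r => r) = 1}

/-- The inclusion into `|K|` of the closed face spanned by a simplex `s`. -/
def faceMap (K : PreAbstractSimplicialComplex V) (s : K.faces)
    (w : stdSimplex ℝ (s.1 : Finset V)) : K.Realization :=
  ⟨(Finsupp.equivFunOnFinite.symm w.1).embDomain (Function.Embedding.subtype _), by
    have hsum : (((Finsupp.equivFunOnFinite.symm w.1).embDomain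
        (Function.Embedding.subtype (· ∈ s.1))).sum fun _ r => r) = 1 := by
      rw [Finsupp.sum_embDomain, Finsupp.sum_fintype _ _ (fun _ => rfl)]
      exact w.2.2
    refine ⟨fun x => ?_, ?_, hsum⟩
    · by_cases hx : x ∈ Set.range (Function.Embedding.subtype (· ∈ s.1))
      · obtain ⟨y, rfl⟩ := hx
        rw [Finsupp.embDomain_apply_self]
        exact w.2.1 y
      · rw [Finsupp.embDomain_of_notMem_range _ _ _ hx]
    · refine (K.isRelLowerSet_faces s.2).2 ?_ ?_
      · intro x hx
        rw [Finsupp.support_embDomain] at hx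
        obtain ⟨y, -, rfl⟩ := Finset.mem_map.1 hx
        exact y.2
      · by_contra h
        rw [Finset.not_nonempty_iff_eq_empty, Finsupp.support_eq_empty] at h
        rw [h, Finsupp.sum_zero_index] at hsum
        exact zero_ne_one hsum⟩

/-- The weak topology: the finest topology making all inclusions of closed faces (with their
Euclidean topology) continuous. -/
instance (K : PreAbstractSimplicialComplex V) : TopologicalSpace K.Realization :=
  ⨆ s : K.faces, TopologicalSpace.coinduced (K.faceMap s) inferInstance

/-- The subset of `|K|` formed by the simplices of `K` that belong to `L`. If `L` is a subcomplex
of `K`, this is `|L|`. -/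
def realizationOf (K L : PreAbstractSimplicialComplex V) : Set K.Realization :=
  {x | x.1.support ∈ L.faces}

/-- The dimensions of the simplices are bounded (the dimension of `s` is `s.card - 1`). -/
def IsFiniteDimensional (K : PreAbstractSimplicialComplex V) : Prop :=
  ∃ n : ℕ, ∀ s ∈ K.faces, s.card ≤ n + 1

/-- A complex is pure if all its maximal simplices have the same dimension. -/
def IsPure (K : PreAbstractSimplicialComplex V) : Prop :=
  ∀ s t : Finset V, Maximal (· ∈ K.faces) s → Maximal (· ∈ K.faces) t → s.card = t.card

end PreAbstractSimplicialComplex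

/-- The order complex of a poset: its simplices are the nonempty finite chains. -/
def orderComplex (P : Type u) [PartialOrder P] : PreAbstractSimplicialComplex P where
  faces := {s | s.Nonempty ∧ IsChain (· ≤ ·) (s : Set P)}
  isRelLowerSet_faces := fun _ hs =>
    ⟨hs.1, fun _ hts ht => ⟨ht, hs.2.mono (Finset.coe_subset.2 hts)⟩⟩

/-! ### Quotients and suspensions of spaces -/

/-- The relation on `Y ⊔ {*}` gluing all points of `A` to `*`. -/
inductive CollapseRel {Y : Type u} (A : Set Y) : Y ⊕ Unit → Y ⊕ Unit → Prop
  | glue (y : Y) (hy : y ∈ A) : CollapseRel A (Sum.inl y) (Sum.inr ())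

/-- The quotient `Y / A`, with base point the class of `*`; in particular `Y / ∅ = Y ⊔ {*}`. -/
def Collapse {Y : Type u} (A : Set Y) : Type u := Quot (CollapseRel A)

instance {Y : Type u} [TopologicalSpace Y] (A : Set Y) : TopologicalSpace (Collapse A) :=
  inferInstanceAs (TopologicalSpace (Quot (CollapseRel A)))

/-- The relation on `Y × [0, 1] ⊔ {south, north}` gluing `Y × {0}` to the south pole `false`
and `Y × {1}` to the north pole `true`. -/
inductive SuspensionRel (Y : Type u) : (Y × I) ⊕ Bool → (Y × I) ⊕ Bool → Prop
  | south (y : Y) : SuspensionRel Y (Sum.inl (y, 0)) (Sum.inr false)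
  | north (y : Y) : SuspensionRel Y (Sum.inl (y, 1)) (Sum.inr true)

/-- The (unreduced) suspension of a space. The suspension of the empty space is the pair of poles,
that is, the sphere of dimension `0`. -/
def Suspension (Y : Type u) : Type u := Quot (SuspensionRel Y)

instance (Y : Type u) [TopologicalSpace Y] : TopologicalSpace (Suspension Y) :=
  inferInstanceAs (TopologicalSpace (Quot (SuspensionRel Y)))

/-! ### The magnitude homotopy type -/

/-- The length `d(x₀, …, xₙ) = d(x₀, x₁) + ⋯ + d(xₙ₋₁, xₙ)` of a sequence of points. -/
def seqLength {X : Type u} [MetricSpace X] : List X → ℝ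
  | [] => 0
  | [_] => 0
  | x :: y :: l => dist x y + seqLength (y :: l)

lemma seqLength_le_cons {X : Type u} [MetricSpace X] (x : X) (l : List X) :
    seqLength l ≤ seqLength (x :: l) := by
  cases l with
  | nil => simp [seqLength]
  | cons y l => simp [seqLength]

lemma seqLength_cons_le {X : Type u} [MetricSpace X] (x y : X) (l : List X) :
    seqLength (x :: l) ≤ dist x y + seqLength (y :: l) := by
  cases l with
  | nil => simp [seqLength]
  | cons z l =>
    simp only [seqLength]
    linarith [dist_triangle x y z]

lemma seqLength_sublist {X : Type u} [MetricSpace X] {l₁ l₂ : List X} (h : l₁.Sublist l₂) :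
    seqLength l₁ ≤ seqLength l₂ ∧ ∀ x, seqLength (x :: l₁) ≤ seqLength (x :: l₂) := by
  induction h with
  | slnil => simp
  | cons y _ ih =>
    refine ⟨ih.1.trans (seqLength_le_cons _ _), fun x => (ih.2 x).trans ?_⟩
    simpa [seqLength] using seqLength_cons_le x y _
  | cons_cons y _ ih =>
    exact ⟨ih.2 y, fun x => by simpa [seqLength] using ih.2 y⟩

/-- The causal interval between `(a, 0)` and `(b, ℓ)`: all `(x, t)` in `X × [0, ℓ]` with
`d(a, x) ≤ t` and `d(x, b) ≤ ℓ - t`. -/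
@[ext]
structure CausalInterval {X : Type u} [MetricSpace X] (ℓ : ℝ) (a b : X) : Type u where
  point : X
  time : ℝ
  time_mem : time ∈ Set.Icc 0 ℓ
  dist_left : dist a point ≤ time
  dist_right : dist point b ≤ ℓ - time

/-- The causal order: `(x, t) ≤ (x', t')` if and only if `d(x, x') ≤ t' - t`. -/
instance {X : Type u} [MetricSpace X] (ℓ : ℝ) (a b : X) :
    PartialOrder (CausalInterval ℓ a b) where
  le p q := dist p.point q.point ≤ q.time - p.time
  le_refl p := by simp
  le_trans p q r hpq hqr := by
    linarith [dist_triangle p.point q.point r.point]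
  le_antisymm p q hpq hqp := by
    have h0 := dist_nonneg (x := p.point) (y := q.point)
    have h1 := dist_nonneg (x := q.point) (y := p.point)
    exact CausalInterval.ext (dist_le_zero.1 (by linarith)) (by linarith)

/-- The subcomplex of the order complex of the causal interval that consists of the chains
`(x₀, t₀) < ⋯ < (xₙ, tₙ)` with `d(x₀, …, xₙ) < ℓ`. -/
def shortComplex {X : Type u} [MetricSpace X] (ℓ : ℝ) (a b : X) :
    PreAbstractSimplicialComplex (CausalInterval ℓ a b) where
  faces := {s | s.Nonempty ∧ ∃ l : List (CausalInterval ℓ a b), l.Pairwise (· < ·) ∧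
    (∀ p, p ∈ l ↔ p ∈ s) ∧ seqLength (l.map CausalInterval.point) < ℓ}
  isRelLowerSet_faces := by
    classical
    rintro s ⟨hs, l, hl, hls, hlen⟩
    refine ⟨hs, fun t hts ht => ⟨ht, l.filter (· ∈ t), hl.filter _, fun p => ?_, ?_⟩⟩
    · simp only [List.mem_filter, decide_eq_true_eq, hls]
      exact ⟨fun h => h.2, fun h => ⟨hts h, h⟩⟩
    · exact (seqLength_sublist (List.filter_sublist.map _)).1.trans_lt hlen

/-- The magnitude homotopy type `M^ℓ(X; a, b)`: the realization of the order complex of the causal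
interval modulo the realization of the subcomplex of chains shorter than `ℓ`. -/
abbrev MagnitudeHomotopyType {X : Type u} [MetricSpace X] (ℓ : ℝ) (a b : X) : Type u :=
  Collapse ((orderComplex (CausalInterval ℓ a b)).realizationOf (shortComplex ℓ a b))

/-! ### Intervals in metric spaces -/

/-- The closed interval `I[a, b]` of all `x` with `d(a, x) + d(x, b) = d(a, b)`. -/
def MetricInterval {X : Type u} [MetricSpace X] (a b : X) : Type u :=
  {x : X // dist a x + dist x b = dist a b}

/-- The interval order: `x ≤ y` if and only if `d(a, x) + d(x, y) + d(y, b) = d(a, b)`. -/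
instance {X : Type u} [MetricSpace X] (a b : X) : PartialOrder (MetricInterval a b) where
  le x y := dist a x.1 + dist x.1 y.1 + dist y.1 b = dist a b
  le_refl x := by simpa using x.2
  le_trans x y z hxy hyz := by
    have hy := y.2
    have h1 := dist_triangle x.1 y.1 z.1
    have h2 := dist_triangle a x.1 b
    have h3 := dist_triangle x.1 z.1 b
    linarith
  le_antisymm x y hxy hyx := by
    have hx := x.2
    have hy := y.2
    have h1 := dist_comm x.1 y.1
    exact Subtype.ext (dist_le_zero.1 (by linarith))

/-- The open interval `I(a, b)`, which is `I[a, b]` without `a` and `b`, with the induced order. -/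
abbrev OpenMetricInterval {X : Type u} [MetricSpace X] (a b : X) : Type u :=
  {x : MetricInterval a b // x.1 ≠ a ∧ x.1 ≠ b}

/-! ### Weighted graphs -/

/-- A weighted graph: a graph with a positive length for each edge. -/
structure WeightedGraph (V : Type u) where
  graph : SimpleGraph V
  length : graph.edgeSet → ℝ
  length_pos : ∀ e, 0 < length e

namespace WeightedGraph

variable {V : Type u} (W : WeightedGraph V)

/-- The edge lengths are bounded below by a positive constant. -/
def BoundedBelow : Prop := ∃ ε : ℝ, 0 < ε ∧ ∀ e, ε ≤ W.length e

/-- The length of a walk, the sum of the lengths of its edges. -/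
def walkLength : {x y : V} → W.graph.Walk x y → ℝ
  | _, _, .nil => 0
  | x, _, .cons (v := z) h p => W.length ⟨s(x, z), h⟩ + walkLength p

lemma walkLength_nonneg {x y : V} (p : W.graph.Walk x y) : 0 ≤ W.walkLength p := by
  induction p with
  | nil => exact le_rfl
  | cons h p ih => exact add_nonneg (W.length_pos _).le ih

lemma walkLength_append {x y z : V} (p : W.graph.Walk x y) (q : W.graph.Walk y z) :
    W.walkLength (p.append q) = W.walkLength p + W.walkLength q := by
  induction p with
  | nil => simp [walkLength]
  | cons h p ih => simp [walkLength, ih, add_assoc]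

lemma walkLength_reverse {x y : V} (p : W.graph.Walk x y) :
    W.walkLength p.reverse = W.walkLength p := by
  induction p with
  | nil => simp [walkLength]
  | cons h p ih =>
    simp [walkLength, walkLength_append, ih, add_comm, Sym2.eq_swap]

/-- The distance of two vertices is the infimum of the lengths of the paths connecting them. -/
def pathDist (x y : V) : ℝ := ⨅ p : W.graph.Walk x y, W.walkLength p

lemma pathDist_le {x y : V} (p : W.graph.Walk x y) : W.pathDist x y ≤ W.walkLength p :=
  ciInf_le ⟨0, by rintro _ ⟨q, rfl⟩; exact W.walkLength_nonneg q⟩ p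

/-- The metric on the vertices of a connected weighted graph with edge lengths bounded below. -/
abbrev metricSpace (hc : W.graph.Connected) (hb : W.BoundedBelow) : MetricSpace V where
  dist := W.pathDist
  dist_self x := by
    refine le_antisymm (W.pathDist_le .nil) ?_
    exact Real.iInf_nonneg fun p => W.walkLength_nonneg p
  dist_comm x y := by
    have key : ∀ x y, W.pathDist x y ≤ W.pathDist y x := fun x y => by
      have : Nonempty (W.graph.Walk y x) := hc.preconnected y x
      exact le_ciInf fun p => (W.walkLength_reverse p) ▸ W.pathDist_le p.reverse
    exact le_antisymm (key x y) (key y x)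
  dist_triangle x y z := by
    have : Nonempty (W.graph.Walk x y) := hc.preconnected x y
    have : Nonempty (W.graph.Walk y z) := hc.preconnected y z
    exact le_ciInf_add_ciInf fun p q => (W.walkLength_append p q) ▸ W.pathDist_le (p.append q)
  eq_of_dist_eq_zero := by
    intro x y h
    by_contra hne
    have : Nonempty (W.graph.Walk x y) := hc.preconnected x y
    obtain ⟨ε, hε, hle⟩ := hb
    have : ε ≤ W.pathDist x y := le_ciInf fun p => by
      cases p with
      | nil => exact absurd rfl hne
      | cons h p => exact (hle _).trans (le_add_of_nonneg_right (W.walkLength_nonneg p))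
    exact (hε.trans_le this).ne' h

/-- A graph, regarded as a weighted graph in which all edges have length `1`. -/
abbrev ofGraph (G : SimpleGraph V) : WeightedGraph V where
  graph := G
  length := fun _ => 1
  length_pos := fun _ => one_pos

lemma ofGraph_boundedBelow (G : SimpleGraph V) : (ofGraph G).BoundedBelow :=
  ⟨1, one_pos, fun _ => le_rfl⟩

/-- The path metric on the vertices of a connected graph with edges of length `1`. -/
abbrev graphMetricSpace (G : SimpleGraph V) (hG : G.Connected) : MetricSpace V :=
  (ofGraph G).metricSpace hG (ofGraph_boundedBelow G)

end WeightedGraph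

end

open Topology

noncomputable section

/-! For `ℓ = d(a, b)` the triangle inequality forces an event `(x, t)` of the causal interval to
satisfy `t = d(a, x)` and `d(a, x) + d(x, b) = d(a, b)`. The causal interval is therefore the closed
metric interval, a poset `Q` with bottom `a` and top `b`, and its open part is `P = I(a, b)`. A
chain is at least as long as the distance of its ends and at most as long as the elapsed time, so it
has length less than `ℓ` exactly when it misses the bottom or the top. Hence the magnitude homotopy
type is `|ΔQ|` modulo the points at which one of the two end coordinates vanishes (`endFaces`).

Now `ΔQ` is the join of `ΔP` with an edge. With `s` the weight of the edge and `t` the ratio in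
which it is divided, a point with coordinates `(y, s, t)` lies in `endFaces` if and only if `s = 0`,
`t = 0` or `t = 1`. So the quotient is `Σ²|ΔP|` with the arc over the south pole of the inner
suspension collapsed (`OpenPart.toCollapse_fibers`, `OpenPart.isQuotientMap_toCollapse`). The south
pole is a nondegenerate base point, and an explicit homotopy shows that collapsing the arc over it
is a homotopy equivalence (`Suspension.nonempty_homotopyEquiv_of_isQuotientMap`).

For the realization of a given complex `Z`, barycentric subdivision identifies `|Z|` with the order
complex of its face poset (`baryHomeomorph`). It remains to make the face poset with added bottom
and top the vertex set of a graph in which the interval between the ends carries the given order.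
Let edges join comparable elements and be as long as the difference of their ranks. A monotone walk
is as long as the difference of the ranks of its ends, and every walk with a descending step exceeds
this by at least `1`. Thus the distance from `x` to `y` equals `r y - r x` if and only if `x ≤ y`
(`WeightedGraph.IsRanked`). Finite dimension bounds the ranks, which leaves room for the top. Purity
makes all covers have rank difference `1`, so that edges of length `1` suffice. -/

lemma Finsupp.sum_eq_linearCombination_one {V : Type*} (f : V →₀ ℝ) :
    (f.sum fun _ r => r) = Finsupp.linearCombination ℝ (fun _ => (1 : ℝ)) f := by
  simp [Finsupp.linearCombination_apply]

/-! ### Topology of geometric realizations -/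

namespace PreAbstractSimplicialComplex

variable {V : Type u} {K : PreAbstractSimplicialComplex V}

lemma face_mono {s t : Finset V} (hs : s ∈ K.faces) (h : t ⊆ s) (ht : t.Nonempty) :
    t ∈ K.faces :=
  (K.isRelLowerSet_faces hs).2 h ht

lemma Realization.support_nonempty (x : K.Realization) : x.1.support.Nonempty :=
  (K.isRelLowerSet_faces x.2.2.1).1

/-- Constructor of points of `|K|` from a finitely supported function with support contained in a
simplex. -/
def Realization.mk (K : PreAbstractSimplicialComplex V) (f : V →₀ ℝ) (s : Finset V)
    (hs : s ∈ K.faces) (h0 : ∀ x, 0 ≤ f x) (hf : f.support ⊆ s)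
    (h1 : (f.sum fun _ r => r) = 1) : K.Realization :=
  ⟨f, h0, face_mono hs hf (by
    by_contra h
    rw [Finset.not_nonempty_iff_eq_empty, Finsupp.support_eq_empty] at h
    rw [h, Finsupp.sum_zero_index] at h1
    exact zero_ne_one h1), h1⟩

lemma faceMap_apply (s : K.faces) (w : stdSimplex ℝ (s.1 : Finset V)) (x : (s.1 : Finset V)) :
    (K.faceMap s w).1 x = w.1 x :=
  Finsupp.embDomain_apply_self (Function.Embedding.subtype _) _ x

lemma faceMap_apply_of_notMem (s : K.faces) (w : stdSimplex ℝ (s.1 : Finset V)) {x : V}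
    (hx : x ∉ s.1) : (K.faceMap s w).1 x = 0 :=
  Finsupp.embDomain_of_notMem_range _ _ _ (by simpa using hx)

lemma support_faceMap_subset (s : K.faces) (w : stdSimplex ℝ (s.1 : Finset V)) :
    (K.faceMap s w).1.support ⊆ s.1 := by
  intro x hx
  by_contra h
  exact Finsupp.mem_support_iff.1 hx (faceMap_apply_of_notMem s w h)

/-- The barycentric coordinates of a point of a closed face. -/
def Realization.faceCoord (s : K.faces) (x : K.Realization) (hx : x.1.support ⊆ s.1) :
    stdSimplex ℝ (s.1 : Finset V) :=
  ⟨fun v => x.1 v, fun v => x.2.1 v, by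
    exact (Finset.sum_coe_sort s.1 (fun v => x.1 v)).trans
      ((Finset.sum_subset hx fun v _ hv => Finsupp.notMem_support_iff.1 hv).symm.trans x.2.2.2)⟩

lemma faceMap_faceCoord (s : K.faces) (x : K.Realization) (hx : x.1.support ⊆ s.1) :
    K.faceMap s (x.faceCoord s hx) = x := by
  refine Subtype.ext (Finsupp.ext fun v => ?_)
  by_cases hv : v ∈ s.1
  · exact faceMap_apply s _ ⟨v, hv⟩
  · rw [faceMap_apply_of_notMem s _ hv]
    exact (Finsupp.notMem_support_iff.1 fun h => hv (hx h)).symm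

lemma continuous_faceMap (s : K.faces) : Continuous (K.faceMap s) :=
  continuous_iSup_rng (i := s) continuous_coinduced_rng

lemma continuous_realization_iff {T : Type*} [TopologicalSpace T] {f : K.Realization → T} :
    Continuous f ↔ ∀ s, Continuous (f ∘ K.faceMap s) := by
  simp only [continuous_iSup_dom, continuous_coinduced_dom]

lemma isClosed_realization_iff {C : Set K.Realization} :
    IsClosed C ↔ ∀ s, IsClosed (K.faceMap s ⁻¹' C) := by
  simp only [isClosed_iSup_iff, isClosed_coinduced]

lemma continuous_coord (v : V) : Continuous fun x : K.Realization => x.1 v := by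
  rw [continuous_realization_iff]
  intro s
  by_cases hv : v ∈ s.1
  · refine ((continuous_apply (⟨v, hv⟩ : (s.1 : Finset V))).comp continuous_subtype_val).congr ?_
    exact fun w => (faceMap_apply s w ⟨v, hv⟩).symm
  · exact continuous_const.congr fun w => (faceMap_apply_of_notMem s w hv).symm

instance : T2Space K.Realization :=
  T2Space.of_injective_continuous (f := fun x : K.Realization => fun v => x.1 v)
    (fun _ _ h => Subtype.ext (Finsupp.ext (congrFun h)))
    (continuous_pi continuous_coord)

/-- A map into one closed face is continuous if its coordinates are. -/
lemma continuous_of_support_subset {T : Type*} [TopologicalSpace T] {g : T → K.Realization}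
    (s : K.faces) (hs : ∀ t, (g t).1.support ⊆ s.1) (hg : ∀ v, Continuous fun t => (g t).1 v) :
    Continuous g := by
  have hc : Continuous fun t => (g t).faceCoord s (hs t) :=
    Continuous.subtype_mk (f := fun t (v : (s.1 : Finset V)) => (g t).1 v)
      (continuous_pi fun v => hg v) fun t => ((g t).faceCoord s (hs t)).2
  have : Continuous fun t => K.faceMap s ((g t).faceCoord s (hs t)) :=
    (continuous_faceMap s).comp hc
  exact this.congr fun t => faceMap_faceCoord s _ (hs t)

/-- The realization is a quotient of the disjoint union of its closed faces. -/
lemma isQuotientMap_sigma_faceMap : IsQuotientMap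
    (fun p : Σ s : K.faces, stdSimplex ℝ (s.1 : Finset V) => K.faceMap p.1 p.2) := by
  refine isQuotientMap_iff_isClosed.2 ⟨fun x => ⟨⟨⟨x.1.support, x.2.2.1⟩,
    x.faceCoord ⟨x.1.support, x.2.2.1⟩ subset_rfl⟩,
    faceMap_faceCoord ⟨x.1.support, x.2.2.1⟩ x subset_rfl⟩, fun C => ?_⟩
  rw [isClosed_realization_iff, isClosed_sigma_iff]
  rfl

/-- Continuity on `|K| × T` can be checked on closed faces if `T` is locally compact. -/
lemma continuous_realization_prod {T Z : Type*} [TopologicalSpace T] [LocallyCompactSpace T]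
    [TopologicalSpace Z] {f : K.Realization × T → Z}
    (hf : ∀ s, Continuous fun p : stdSimplex ℝ (s.1 : Finset V) × T => f (K.faceMap s p.1, p.2)) :
    Continuous f := by
  refine isQuotientMap_sigma_faceMap.continuous_lift_prod_left ?_
  refine ((Homeomorph.sigmaProdDistrib (X := fun s : K.faces => stdSimplex ℝ (s.1 : Finset V))
    (Y := T)).symm.comp_continuous_iff').1 ?_
  exact continuous_sigma fun s => hf s

/-- A continuous map to a Hausdorff quotient of `|K|` is a quotient map if the image of each closed
face is covered by the image of a compact set. -/
lemma isQuotientMap_of_isCompact {X T : Type*} [TopologicalSpace X] [TopologicalSpace T] [T2Space T]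
    {p : K.Realization → T} (hp : IsQuotientMap p) {f : X → T} (hf : Continuous f)
    (h : ∀ s : K.faces, ∃ B : Set X, IsCompact B ∧ ∀ w, p (K.faceMap s w) ∈ f '' B) :
    IsQuotientMap f := by
  refine isQuotientMap_iff_isClosed.2 ⟨fun t => ?_, fun C => ⟨fun hC => hC.preimage hf, fun hC => ?_⟩⟩
  · obtain ⟨x, rfl⟩ := hp.surjective t
    obtain ⟨B, -, hB⟩ := h ⟨_, x.2.2.1⟩
    obtain ⟨y, -, hy⟩ := hB (x.faceCoord ⟨_, x.2.2.1⟩ subset_rfl)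
    exact ⟨y, by rw [hy, faceMap_faceCoord]⟩
  · rw [← hp.isClosed_preimage, isClosed_realization_iff]
    intro s
    obtain ⟨B, hB, hs⟩ := h s
    -- The image of the compact set `B ∩ f ⁻¹' C` is compact, hence closed in the Hausdorff space
    -- `T`. On the given face it has the same preimage as `C`, because `B` already covers the face.
    have hcl : IsClosed (f '' (B ∩ f ⁻¹' C)) := ((hB.inter_right hC).image hf).isClosed
    convert hcl.preimage (hp.continuous.comp (continuous_faceMap s)) using 1
    ext w
    constructor
    · intro hw
      obtain ⟨x, hx, hxw⟩ := hs w
      exact ⟨x, ⟨hx, by simpa [hxw] using hw⟩, hxw⟩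
    · rintro ⟨x, ⟨-, hx⟩, hxw⟩
      rw [Set.mem_preimage, hxw] at hx
      exact hx

end PreAbstractSimplicialComplex

/-! ### Coordinates and continuity on suspensions -/

namespace Suspension

variable {Y : Type u}

/-- The point of the suspension with coordinates `y` and `t`. -/
def mk (y : Y) (t : I) : Suspension Y := Quot.mk _ (Sum.inl (y, t))

/-- The poles of the suspension: `false` is the south pole and `true` is the north pole. -/
def pole (b : Bool) : Suspension Y := Quot.mk _ (Sum.inr b)

lemma mk_zero (y : Y) : mk y 0 = pole false := Quot.sound (.south y)

lemma mk_one (y : Y) : mk y 1 = pole true := Quot.sound (.north y)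

/-- Maps out of a suspension. -/
def lift {Z : Type*} (f : Y → I → Z) (p : Bool → Z) (h0 : ∀ y, f y 0 = p false)
    (h1 : ∀ y, f y 1 = p true) : Suspension Y → Z :=
  Quot.lift (Sum.elim (fun x => f x.1 x.2) p) (by
    rintro _ _ (y | y)
    · exact h0 y
    · exact h1 y)

lemma ind {motive : Suspension Y → Prop} (hm : ∀ y t, motive (mk y t))
    (hp : ∀ b, motive (pole b)) (x : Suspension Y) : motive x := by
  obtain ⟨⟨y, t⟩ | b⟩ := x
  · exact hm y t
  · exact hp b

/-- The point of the suspension with coordinates `y` and `r`, with `r` clamped to `[0, 1]`. -/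
def clamp (y : Y) (r : ℝ) : Suspension Y := mk y (Set.projIcc 0 1 zero_le_one r)

lemma clamp_of_le_zero (y : Y) {r : ℝ} (hr : r ≤ 0) : clamp y r = pole false := by
  rw [clamp, Set.projIcc_of_le_left _ hr]; exact mk_zero y

lemma clamp_of_one_le (y : Y) {r : ℝ} (hr : 1 ≤ r) : clamp y r = pole true := by
  rw [clamp, Set.projIcc_of_right_le _ hr]; exact mk_one y

lemma clamp_coe (y : Y) (t : I) : clamp y (t : ℝ) = mk y t := by
  rw [clamp, Set.projIcc_val]

variable [TopologicalSpace Y]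

lemma continuous_mk : Continuous fun p : Y × I => mk p.1 p.2 :=
  continuous_quot_mk.comp continuous_inl

lemma continuous_clamp : Continuous fun p : Y × ℝ => clamp p.1 p.2 :=
  continuous_mk.comp (continuous_fst.prodMk ((continuous_projIcc (h := zero_le_one)).comp continuous_snd))

/-- Continuity on `ΣY × T` can be checked on the coordinates if `T` is locally compact. -/
lemma continuous_prod {T Z : Type*} [TopologicalSpace T] [LocallyCompactSpace T]
    [TopologicalSpace Z] {f : Suspension Y × T → Z}
    (hm : Continuous fun p : (Y × I) × T => f (mk p.1.1 p.1.2, p.2))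
    (hp : ∀ b, Continuous fun t => f (pole b, t)) : Continuous f := by
  refine (isQuotientMap_quot_mk (r := SuspensionRel Y)).continuous_lift_prod_left ?_
  refine ((Homeomorph.sumProdDistrib (X := Y × I) (Y := Bool) (Z := T)).symm.comp_continuous_iff').1
    ?_
  exact continuous_sum_dom.2 ⟨hm, continuous_prod_of_discrete_left.2 hp⟩

lemma continuous_of {Z : Type*} [TopologicalSpace Z] {f : Suspension Y → Z}
    (hm : Continuous fun p : Y × I => f (mk p.1 p.2)) : Continuous f :=
  continuous_coinduced_dom.2 (continuous_sum_dom.2 ⟨hm, continuous_of_discreteTopology⟩)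

/-- The map of suspensions induced by a map. -/
def map {Y' : Type v} (e : Y → Y') : Suspension Y → Suspension Y' :=
  lift (fun y t => mk (e y) t) pole (fun _ => mk_zero _) (fun _ => mk_one _)

/-- The homeomorphism of suspensions induced by a homeomorphism. -/
def homeomorph {Y' : Type v} [TopologicalSpace Y'] (e : Y ≃ₜ Y') :
    Suspension Y ≃ₜ Suspension Y' where
  toFun := map e
  invFun := map e.symm
  left_inv := ind (fun y t => congrArg (mk · t) (e.symm_apply_apply y)) fun _ => rfl
  right_inv := ind (fun y t => congrArg (mk · t) (e.apply_symm_apply y)) fun _ => rfl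
  continuous_toFun := continuous_of (continuous_mk.comp (e.continuous.prodMap continuous_id))
  continuous_invFun := continuous_of (continuous_mk.comp (e.symm.continuous.prodMap continuous_id))

end Suspension

/-! ### Collapsing an arc in a suspension -/

/-- A quotient map is a homotopy equivalence if there is a homotopy from the identity to a map that
is constant on its fibers, through maps that preserve the relation of lying in one fiber. -/
theorem Topology.IsQuotientMap.nonempty_homotopyEquiv {X Q : Type*} [TopologicalSpace X]
    [TopologicalSpace Q] {q : X → Q} (hq : IsQuotientMap q) {H : X × I → X} (hH : Continuous H)
    (h0 : ∀ x, H (x, 0) = x) (hrel : ∀ x y, q x = q y → ∀ t, q (H (x, t)) = q (H (y, t)))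
    (h1 : ∀ x y, q x = q y → H (x, 1) = H (y, 1)) : Nonempty (X ≃ₕ Q) := by
  obtain ⟨g, hg⟩ := hq.surjective.hasRightInverse
  -- The section `g` need not be continuous: `H (·, 1)` is constant on fibers, so composing it with
  -- `g` gives the induced map on the quotient.
  have hr : ∀ x, H (g (q x), 1) = H (x, 1) := fun x => h1 _ _ (hg _)
  have hrc : Continuous fun z => H (g z, 1) := hq.continuous_iff.2
    (((hH.comp (continuous_id.prodMk continuous_const)) : Continuous fun x => H (x, 1)).congr
      fun x => (hr x).symm)
  have hHq : Continuous fun p : Q × I => q (H (g p.1, p.2)) :=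
    hq.continuous_lift_prod_left ((hq.continuous.comp hH).congr fun p => hrel _ _ (hg _).symm _)
  refine ⟨⟨⟨q, hq.continuous⟩, ⟨fun z => H (g z, 1), hrc⟩, ⟨?_⟩, ⟨?_⟩⟩⟩
  · exact (ContinuousMap.Homotopy.mk ⟨fun p => H (p.2, p.1), hH.comp continuous_swap⟩
      h0 (fun x => (hr x).symm)).symm
  · exact (ContinuousMap.Homotopy.mk ⟨fun p => q (H (g p.2, p.1)), hHq.comp continuous_swap⟩
      (fun z => (congrArg q (h0 _)).trans (hg z)) (fun _ => rfl)).symm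

namespace Suspension

section Arc

variable {W : Type u} (w₀ : W) (u : W → ℝ) (h : W × I → W)

open Classical in
/-- In coordinates, the homotopy of `ΣW` that contracts the arc over `w₀` to the south pole. The
pair `u`, `h` witnesses that `w₀` is a nondegenerate base point. -/
def arcFun (τ : I) (w : W) (t : I) : Suspension W :=
  -- The meridian through `w` is run at speed `1 + τ`: it reaches the north pole at `t = 1 / (1 +
  -- τ)` and then descends along the arc over `w₀` to height `1 - τ`. The cap `1 - τ + 2 * u w`
  -- keeps the arc itself, where `u = 0`, below height `1 - τ`; it has no effect once `2 * u w ≥ τ`.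
  if (t : ℝ) * (1 + τ) ≤ 1 then clamp (h (w, τ)) (min (t * (1 + τ)) (1 - τ + 2 * u w))
  else clamp w₀ (min (2 - t * (1 + τ)) (1 - τ + 2 * u w))

variable {w₀ u h}

lemma arcFun_zero (hu : ∀ w, 0 ≤ u w) (τ : I) (w : W) : arcFun w₀ u h τ w 0 = pole false := by
  have := hu w
  have := τ.2.2
  rw [arcFun, if_pos (by simp)]
  exact clamp_of_le_zero _ (by simp)

lemma arcFun_one (hu : ∀ w, 0 ≤ u w) (τ : I) (w : W) :
    arcFun w₀ u h τ w 1 = clamp w₀ (1 - τ) := by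
  have := hu w
  have h0 := τ.2.1
  rw [arcFun]
  -- At `t = 1` the first branch occurs only for `τ = 0`, when both sides are the north pole.
  split_ifs with hτ
  · simp only [Set.Icc.coe_one, one_mul] at hτ
    have : (τ : ℝ) = 0 := by linarith
    rw [clamp_of_one_le _ (by simp [this, hu w]), clamp_of_one_le _ (by simp [this])]
  · congr 1
    rw [min_eq_left] <;> simp <;> linarith

/-- The homotopy of `ΣW` that contracts the arc over `w₀` to the south pole. -/
def arcHomotopy (hu : ∀ w, 0 ≤ u w) (p : Suspension W × I) : Suspension W :=
  lift (arcFun w₀ u h p.2) (fun b => if b then clamp w₀ (1 - p.2) else pole false)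
    (arcFun_zero hu p.2) (arcFun_one hu p.2) p.1

variable [TopologicalSpace W]

lemma continuous_arcHomotopy (hu : ∀ w, 0 ≤ u w) (huc : Continuous u) (hc : Continuous h)
    (hw : ∀ w τ, 2 * u w ≤ (τ : I) → h (w, τ) = w₀) :
    Continuous (arcHomotopy (w₀ := w₀) (h := h) hu) := by
  refine continuous_prod ?_ ?_
  · change Continuous fun p : (W × I) × I => arcFun w₀ u h p.2 p.1.1 p.1.2
    refine Continuous.if_le ?_ ?_ (by fun_prop) continuous_const ?_
    · exact continuous_clamp.comp ((hc.comp (by fun_prop)).prodMk (by fun_prop))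
    · exact continuous_clamp.comp (continuous_const.prodMk (by fun_prop))
    · rintro ⟨⟨w, t⟩, τ⟩ ht
      dsimp only at ht ⊢
      rw [ht]
      -- The branches agree where they meet: if `2 * u w ≤ τ`, then `h (w, τ) = w₀` and both lie on
      -- the arc over `w₀` at the same height; otherwise the cap exceeds `1` and both are the north
      -- pole.
      rcases le_or_gt (2 * u w) τ with hle | hlt
      · rw [hw w τ hle]; norm_num
      · rw [clamp_of_one_le _ (le_min le_rfl (by linarith)),
          clamp_of_one_le _ (le_min (by linarith) (by linarith))]
  · rintro (_ | _)
    · exact continuous_const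
    · exact continuous_clamp.comp (continuous_const.prodMk (by fun_prop))

/-- Collapsing the arc over a nondegenerate base point `w₀` is a homotopy equivalence. -/
theorem nonempty_homotopyEquiv_of_isQuotientMap {Q : Type*} [TopologicalSpace Q]
    (hu : ∀ w, 0 ≤ u w) (huc : Continuous u) (hc : Continuous h) (hw₀ : u w₀ = 0)
    (hw : ∀ w τ, 2 * u w ≤ (τ : I) → h (w, τ) = w₀) (h0 : ∀ w, h (w, 0) = w)
    {q : Suspension W → Q} (hq : IsQuotientMap q)
    (hfib : ∀ x y, q x = q y → x = y ∨ (x ∈ Set.range (mk w₀) ∧ y ∈ Set.range (mk w₀)))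
    (harc : ∀ s t, q (mk w₀ s) = q (mk w₀ t)) :
    Nonempty (Suspension W ≃ₕ Q) := by
  -- The homotopy keeps the arc inside itself and below height `1 - τ`, so at `τ = 1` the whole arc
  -- is at the south pole.
  have hA : ∀ τ t, ∃ r : ℝ, arcHomotopy (w₀ := w₀) (h := h) hu (mk w₀ t, τ) = clamp w₀ r ∧
      r ≤ 1 - τ := by
    intro τ t
    have hh : h (w₀, τ) = w₀ := hw _ _ (by rw [hw₀]; simpa using τ.2.1)
    change ∃ r : ℝ, arcFun w₀ u h τ w₀ t = clamp w₀ r ∧ r ≤ 1 - τ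
    rw [arcFun, hh, hw₀]
    split_ifs
    · exact ⟨_, rfl, by simp⟩
    · exact ⟨_, rfl, by simp⟩
  refine hq.nonempty_homotopyEquiv (continuous_arcHomotopy hu huc hc hw) ?_ ?_ ?_
  · refine ind (fun w t => ?_) ?_
    · change arcFun w₀ u h 0 w t = _
      have := hu w
      have := t.2.2
      rw [arcFun, if_pos (by simpa using t.2.2), h0, ← clamp_coe]
      congr 1
      rw [min_eq_left] <;> simp
      linarith
    · rintro (_ | _)
      · rfl
      · exact clamp_of_one_le _ (by simp)
  · intro x y hxy τ
    obtain rfl | ⟨⟨s, rfl⟩, ⟨t, rfl⟩⟩ := hfib x y hxy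
    · rfl
    · obtain ⟨r, hr, -⟩ := hA τ s
      obtain ⟨r', hr', -⟩ := hA τ t
      rw [hr, hr']
      exact harc _ _
  · intro x y hxy
    obtain rfl | ⟨⟨s, rfl⟩, ⟨t, rfl⟩⟩ := hfib x y hxy
    · rfl
    · obtain ⟨r, hr, hr0⟩ := hA 1 s
      obtain ⟨r', hr', hr0'⟩ := hA 1 t
      rw [hr, hr', clamp_of_le_zero _ (by simpa using hr0), clamp_of_le_zero _ (by simpa using hr0')]

end Arc

variable {Y : Type u}

/-- The height function on a suspension. -/
def height : Suspension Y → ℝ :=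
  lift (fun _ t => (t : ℝ)) (fun b => if b then 1 else 0) (by simp) (by simp)

/-- The deformation of a suspension that pushes a neighborhood of the south pole into it. -/
def push (p : Suspension Y × I) : Suspension Y :=
  -- The heights are rescaled affinely so that `τ / 2` goes to `0` and `1` is fixed; everything
  -- below `τ / 2` is clamped to the south pole.
  lift (fun y t => clamp y ((t - p.2 / 2) / (1 - p.2 / 2))) pole
    (fun y => clamp_of_le_zero _ (by
      have h0 := p.2.2.1
      have h1 := p.2.2.2
      exact div_nonpos_of_nonpos_of_nonneg (by simp; linarith) (by linarith)))
    (fun y => clamp_of_one_le _ (by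
      have h1 := p.2.2.2
      rw [Set.Icc.coe_one, div_self (by linarith)])) p.1

lemma height_nonneg (x : Suspension Y) : 0 ≤ height x := by
  refine ind (motive := fun x => 0 ≤ height x) (fun y t => t.2.1) ?_ x
  rintro (_ | _)
  · exact le_rfl
  · exact zero_le_one

lemma push_eq_pole (x : Suspension Y) (τ : I) (hx : 2 * height x ≤ τ) :
    push (x, τ) = pole false := by
  revert hx
  refine ind (motive := fun x => 2 * height x ≤ τ → push (x, τ) = pole false)
    (fun y t ht => ?_) ?_ x
  · have h1 := τ.2.2
    have ht : 2 * (t : ℝ) ≤ τ := ht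
    exact clamp_of_le_zero _ (div_nonpos_of_nonpos_of_nonneg (by simp; linarith) (by simp; linarith))
  · rintro (_ | _) h
    · rfl
    · have h1 := τ.2.2
      have h2 : 2 * (1 : ℝ) ≤ τ := h
      linarith

lemma push_zero (x : Suspension Y) : push (x, 0) = x := by
  refine ind (motive := fun x => push (x, 0) = x) (fun y t => ?_) (fun _ => rfl) x
  change clamp y ((t - (0 : I) / 2) / (1 - (0 : I) / 2)) = _
  simp [clamp_coe]

variable [TopologicalSpace Y]

lemma continuous_height : Continuous (height (Y := Y)) :=
  continuous_of (continuous_subtype_val.comp continuous_snd)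

lemma continuous_push : Continuous (push (Y := Y)) := by
  refine continuous_prod ?_ fun b => continuous_const
  refine continuous_clamp.comp ((by fun_prop : Continuous fun p : (Y × I) × I => p.1.1).prodMk ?_)
  refine Continuous.div (by fun_prop) (by fun_prop) fun p => ?_
  have := p.2.2.2
  exact ne_of_gt (by linarith)

/-- Collapsing the arc over the south pole of `ΣY` is a homotopy equivalence on `Σ²Y`. -/
theorem nonempty_homotopyEquiv_of_isQuotientMap_pole {Q : Type*} [TopologicalSpace Q]
    {q : Suspension (Suspension Y) → Q} (hq : IsQuotientMap q)
    (hfib : ∀ x y, q x = q y → x = y ∨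
      (x ∈ Set.range (mk (pole false)) ∧ y ∈ Set.range (mk (pole false))))
    (harc : ∀ s t, q (mk (pole false) s) = q (mk (pole false) t)) :
    Nonempty (Suspension (Suspension Y) ≃ₕ Q) :=
  nonempty_homotopyEquiv_of_isQuotientMap height_nonneg continuous_height continuous_push rfl
    push_eq_pole push_zero hq hfib harc

end Suspension

/-! ### Compact sets, quotients and join coordinates -/

namespace PreAbstractSimplicialComplex

/-- A finite set has finitely many subsets, so this is a finite union of compact closed faces. It
supplies the compact sets needed in `isQuotientMap_of_isCompact`. -/
lemma isCompact_support_subset {V : Type u} {K : PreAbstractSimplicialComplex V} (s : Finset V) :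
    IsCompact {x : K.Realization | x.1.support ⊆ s} := by
  have hfin : {t : K.faces | t.1 ⊆ s}.Finite :=
    Set.Finite.of_finite_image ((Finset.finite_toSet s.powerset).subset (by
      rintro _ ⟨t, ht, rfl⟩
      simpa using ht)) Subtype.val_injective.injOn
  convert hfin.isCompact_biUnion fun t _ => isCompact_range (continuous_faceMap t) using 1
  ext x
  simp only [Set.mem_ofPred_eq, Set.mem_iUnion, exists_prop]
  constructor
  · exact fun hx => ⟨⟨x.1.support, x.2.2.1⟩, hx,
      x.faceCoord ⟨x.1.support, x.2.2.1⟩ subset_rfl,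
      faceMap_faceCoord ⟨x.1.support, x.2.2.1⟩ x subset_rfl⟩
  · rintro ⟨t, ht, w, rfl⟩
    exact (support_faceMap_subset t w).trans ht

end PreAbstractSimplicialComplex

open PreAbstractSimplicialComplex

namespace Collapse

variable {Y : Type u}

/-- The quotient map `Y → Y / A`. -/
def mk (A : Set Y) (y : Y) : Collapse A := Quot.mk _ (Sum.inl y)

/-- The base point of `Y / A`. -/
def base (A : Set Y) : Collapse A := Quot.mk _ (Sum.inr ())

lemma mk_eq_base {A : Set Y} {y : Y} (hy : y ∈ A) : mk A y = base A := Quot.sound (.glue y hy)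

/-- Without a point in `A` the added base point would not be in the image. -/
lemma isQuotientMap_mk [TopologicalSpace Y] {A : Set Y} (hA : A.Nonempty) :
    IsQuotientMap (mk A) := by
  refine isQuotientMap_iff_isClosed.2 ⟨?_, fun C => ?_⟩
  · rintro ⟨y | _⟩
    · exact ⟨y, rfl⟩
    · exact ⟨_, mk_eq_base hA.choose_spec⟩
  · have h : IsQuotientMap (Y := Collapse A) (Quot.mk (CollapseRel A)) :=
      isQuotientMap_quot_mk
    rw [← h.isClosed_preimage, isClosed_sum_iff]
    exact and_iff_left (isClosed_discrete _)

end Collapse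

/-- The points of `|ΔQ|` for which one of the two given coordinates vanishes. -/
def endFaces {Q : Type u} [PartialOrder Q] (o l : Q) : Set (orderComplex Q).Realization :=
  {x | x.1 o = 0 ∨ x.1 l = 0}

section JoinCoord

variable {P : Type v} {Q : Type u} [PartialOrder P] [PartialOrder Q] {o l : Q}

/-- A coordinate function that separates the points of `|ΔQ| / endFaces o l`. -/
def collapseCoord (o l : Q) : Collapse (endFaces o l) → Q → ℝ :=
  Quot.lift (Sum.elim (fun x q => x.1 o * x.1 l * x.1 q) 0) (by
    rintro _ _ ⟨x, hx | hx⟩ <;> ext q <;> simp [hx])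

lemma continuous_collapseCoord (o l : Q) : Continuous (collapseCoord o l) :=
  continuous_coinduced_dom.2 (continuous_sum_dom.2 ⟨continuous_pi fun q =>
    ((continuous_coord o).mul (continuous_coord l)).mul (continuous_coord q),
    continuous_of_discreteTopology⟩)

/-- The barycentric coordinates sum to `1`, so summing the values `x o * x l * x q` over `q`
recovers the factor `x o * x l`, which is nonzero off the end faces and can be cancelled. -/
lemma eq_of_collapseCoord_eq {x y : (orderComplex Q).Realization} (hx : x ∉ endFaces o l)
    (h : collapseCoord o l (Collapse.mk _ x) = collapseCoord o l (Collapse.mk _ y)) : x = y := by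
  have h1 : (x.1 o * x.1 l) • x.1 = (y.1 o * y.1 l) • y.1 := Finsupp.ext fun q => congrFun h q
  have h2 := congrArg (Finsupp.linearCombination ℝ (fun _ => (1 : ℝ))) h1
  rw [map_smul, map_smul, ← Finsupp.sum_eq_linearCombination_one,
    ← Finsupp.sum_eq_linearCombination_one, x.2.2.2, y.2.2.2, smul_eq_mul, mul_one, smul_eq_mul,
    mul_one] at h2
  rw [← h2] at h1
  have h3 : x.1 o * x.1 l ≠ 0 := fun h => hx (mul_eq_zero.1 h)
  exact Subtype.ext (smul_right_injective _ h3 h1)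

lemma collapseCoord_mk_ne_zero {x : (orderComplex Q).Realization} (hx : x ∉ endFaces o l) :
    collapseCoord o l (Collapse.mk _ x) ≠ 0 := by
  intro h
  have h3 : x.1 o * x.1 l ≠ 0 := fun h => hx (mul_eq_zero.1 h)
  have : x.1 o * x.1 l * x.1 o = 0 := congrFun h o
  exact mul_ne_zero h3 (left_ne_zero_of_mul h3) this

lemma collapseCoord_injective : Function.Injective (collapseCoord o l) := by
  rintro ⟨x | _⟩ ⟨y | _⟩ h
  · by_cases hx : x ∈ endFaces o l
    · by_cases hy : y ∈ endFaces o l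
      · exact (Collapse.mk_eq_base hx).trans (Collapse.mk_eq_base hy).symm
      · exact congrArg (Collapse.mk _) (eq_of_collapseCoord_eq hy h.symm).symm
    · exact congrArg (Collapse.mk _) (eq_of_collapseCoord_eq hx h)
  · by_cases hx : x ∈ endFaces o l
    · exact Collapse.mk_eq_base hx
    · exact absurd h (collapseCoord_mk_ne_zero hx)
  · by_cases hy : y ∈ endFaces o l
    · exact (Collapse.mk_eq_base hy).symm
    · exact absurd h.symm (collapseCoord_mk_ne_zero hy)
  · rfl

instance : T2Space (Collapse (endFaces o l)) :=
  T2Space.of_injective_continuous collapseCoord_injective (continuous_collapseCoord o l)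

variable (ι : P ↪o Q)

/-- The point of the join with an edge `{o, l}` that has weight `s` on the edge, on which it divides
in the ratio given by `t`. -/
def joinFun (o l : Q) (f : P →₀ ℝ) (s t : ℝ) : Q →₀ ℝ :=
  (1 - s) • f.embDomain ι.toEmbedding + (Finsupp.single o (s * t) + Finsupp.single l (s * (1 - t)))

variable {ι}

lemma sum_joinFun {f : P →₀ ℝ} {s : ℝ} (hf : (1 - s) * (f.sum fun _ r => r) = 1 - s) (t : ℝ) :
    ((joinFun ι o l f s t).sum fun _ r => r) = 1 := by
  have : Finsupp.linearCombination ℝ (fun _ => (1 : ℝ)) (f.embDomain ι.toEmbedding) =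
      f.sum fun _ r => r := by
    rw [Finsupp.linearCombination_embDomain, Finsupp.sum_eq_linearCombination_one]; rfl
  rw [Finsupp.sum_eq_linearCombination_one, joinFun]
  simp only [map_add, map_smul, this, Finsupp.linearCombination_single, smul_eq_mul, hf]
  ring

lemma joinFun_nonneg {f : P →₀ ℝ} (hf : ∀ x, 0 ≤ f x) (s t : I) (x : Q) :
    0 ≤ joinFun ι o l f s t x := by
  classical
  have hs := s.2.1
  have hs' := s.2.2
  have ht := t.2.1
  have ht' := t.2.2
  have h1 : 0 ≤ (f.embDomain ι.toEmbedding) x := by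
    by_cases hx : x ∈ Set.range ι.toEmbedding
    · obtain ⟨y, rfl⟩ := hx
      rw [Finsupp.embDomain_apply_self]
      exact hf y
    · rw [Finsupp.embDomain_of_notMem_range _ _ _ hx]
  simp only [joinFun, Finsupp.add_apply, Finsupp.smul_apply, smul_eq_mul, Finsupp.single_apply]
  refine add_nonneg (mul_nonneg (by linarith) h1) (add_nonneg ?_ ?_) <;> split_ifs
  · exact mul_nonneg hs ht
  · exact le_rfl
  · exact mul_nonneg hs (by linarith)
  · exact le_rfl

open Classical in
lemma support_joinFun_subset (f : P →₀ ℝ) (s t : ℝ) :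
    (joinFun ι o l f s t).support ⊆ {o, l} ∪ f.support.map ι.toEmbedding := by
  intro x hx
  by_contra h
  simp only [Finset.mem_union, Finset.mem_insert, Finset.mem_singleton, not_or] at h
  refine Finsupp.mem_support_iff.1 hx ?_
  rw [← Finsupp.support_embDomain, Finsupp.notMem_support_iff] at h
  simp [joinFun, h.2, Ne.symm h.1.1, Ne.symm h.1.2]

lemma joinFun_apply_embedding (ho : o ∉ Set.range ι) (hl : l ∉ Set.range ι) (f : P →₀ ℝ) (s t : ℝ)
    (x : P) : joinFun ι o l f s t (ι x) = (1 - s) * f x := by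
  have h1 : ι x ≠ o := fun h => ho ⟨x, h⟩
  have h2 : ι x ≠ l := fun h => hl ⟨x, h⟩
  have h3 := Finsupp.embDomain_apply_self ι.toEmbedding f x
  simp only [RelEmbedding.coe_toEmbedding] at h3
  simp [joinFun, h1, h2, h3]

lemma joinFun_apply_left (ho : o ∉ Set.range ι) (hol : o ≠ l) (f : P →₀ ℝ) (s t : ℝ) :
    joinFun ι o l f s t o = s * t := by
  simp [joinFun, hol, Finsupp.embDomain_of_notMem_range ι.toEmbedding f o (by simpa using ho)]

lemma joinFun_apply_right (hl : l ∉ Set.range ι) (hol : o ≠ l) (f : P →₀ ℝ) (s t : ℝ) :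
    joinFun ι o l f s t l = s * (1 - t) := by
  simp [joinFun, hol.symm,
    Finsupp.embDomain_of_notMem_range ι.toEmbedding f l (by simpa using hl)]

lemma joinFun_one (f : P →₀ ℝ) (t : ℝ) : joinFun ι o l f 1 t = joinFun ι o l 0 1 t := by
  simp [joinFun]

open Classical in
lemma isChain_join (ho : ∀ x, o ≤ x) (hl : ∀ x, x ≤ l) {s : Finset P}
    (hs : IsChain (· ≤ ·) (s : Set P)) :
    ({o, l} ∪ s.map ι.toEmbedding) ∈ (orderComplex Q).faces := by
  refine ⟨⟨o, by simp⟩, ?_⟩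
  intro x hx y hy _
  simp only [Finset.coe_union, Finset.coe_insert, Finset.coe_singleton, Finset.coe_map,
    Set.mem_union, Set.mem_insert_iff, Set.mem_singleton_iff, Set.mem_image] at hx hy
  rcases hx with (rfl | rfl) | ⟨x, hx, rfl⟩
  · exact Or.inl (ho y)
  · exact Or.inr (hl y)
  · rcases hy with (rfl | rfl) | ⟨y, hy, rfl⟩
    · exact Or.inr (ho _)
    · exact Or.inl (hl _)
    · rcases hs.total hx hy with h | h
      · exact Or.inl (ι.monotone h)
      · exact Or.inr (ι.monotone h)

end JoinCoord

/-- A point of the double suspension lies on the arc over the south pole, or has coordinates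
different from `0` and `1`, or lies on the edge. -/
lemma Suspension.double_cases {Y : Type u} (x : Suspension (Suspension Y)) :
    x ∈ Set.range (Suspension.mk (Suspension.pole false)) ∨
    (∃ t : I, 0 < (t : ℝ) ∧ (t : ℝ) < 1 ∧ x = Suspension.mk (Suspension.pole true) t) ∨
    ∃ y, ∃ s t : I, 0 < (s : ℝ) ∧ (s : ℝ) < 1 ∧ 0 < (t : ℝ) ∧ (t : ℝ) < 1 ∧
      x = Suspension.mk (Suspension.mk y s) t := by
  obtain ⟨⟨w, t⟩ | b⟩ := x
  · change Suspension.mk w t ∈ _ ∨ (∃ _, _ ∧ _ ∧ Suspension.mk w t = _) ∨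
      ∃ _ _ _, _ ∧ _ ∧ _ ∧ _ ∧ Suspension.mk w t = _
    rcases t.2.1.eq_or_lt with h | ht0
    · left
      obtain rfl : t = 0 := Subtype.ext h.symm
      exact ⟨0, by rw [Suspension.mk_zero, Suspension.mk_zero]⟩
    rcases t.2.2.eq_or_lt with h | ht1
    · left
      obtain rfl : t = 1 := Subtype.ext h
      exact ⟨1, by rw [Suspension.mk_one, Suspension.mk_one]⟩
    obtain ⟨⟨y, s⟩ | b⟩ := w
    · change Suspension.mk (Suspension.mk y s) t ∈ _ ∨
        (∃ _, _ ∧ _ ∧ Suspension.mk (Suspension.mk y s) t = _) ∨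
        ∃ _ _ _, _ ∧ _ ∧ _ ∧ _ ∧ Suspension.mk (Suspension.mk y s) t = _
      rcases s.2.1.eq_or_lt with h | hs0
      · left
        obtain rfl : s = 0 := Subtype.ext h.symm
        exact ⟨t, by rw [Suspension.mk_zero]⟩
      rcases s.2.2.eq_or_lt with h | hs1
      · right; left
        obtain rfl : s = 1 := Subtype.ext h
        exact ⟨t, ht0, ht1, by rw [Suspension.mk_one]⟩
      exact Or.inr (Or.inr ⟨y, s, t, hs0, hs1, ht0, ht1, rfl⟩)
    · cases b
      · exact Or.inl ⟨t, rfl⟩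
      · exact Or.inr (Or.inl ⟨t, ht0, ht1, rfl⟩)
  · left
    cases b
    · exact ⟨0, Suspension.mk_zero _⟩
    · exact ⟨1, Suspension.mk_one _⟩

/-! ### The quotient by the end faces as a collapsed double suspension -/

/-- An identification of `P` with the open part of a poset `Q` with a bottom and a top. -/
structure OpenPart (P : Type v) {Q : Type u} [PartialOrder P] [PartialOrder Q] (o l : Q) where
  emb : P ↪o Q
  bot_le : ∀ x, o ≤ x
  le_top : ∀ x, x ≤ l
  bot_ne_top : o ≠ l
  range_eq : Set.range emb = {x | x ≠ o ∧ x ≠ l}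

namespace OpenPart

variable {P : Type v} {Q : Type u} [PartialOrder P] [PartialOrder Q] {o l : Q} (e : OpenPart P o l)

include e

lemma bot_notMem_range : o ∉ Set.range e.emb := fun h => by
  have : o ∈ {x | x ≠ o ∧ x ≠ l} := e.range_eq ▸ h
  exact this.1 rfl

lemma top_notMem_range : l ∉ Set.range e.emb := fun h => by
  have : l ∈ {x | x ≠ o ∧ x ≠ l} := e.range_eq ▸ h
  exact this.2 rfl

lemma mem_range {x : Q} (h1 : x ≠ o) (h2 : x ≠ l) : ∃ y, e.emb y = x := by
  have : x ∈ {x | x ≠ o ∧ x ≠ l} := ⟨h1, h2⟩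
  rw [← e.range_eq] at this
  exact this

/-- The join parametrization of `|ΔQ|`. -/
def join (y : (orderComplex P).Realization) (s t : I) : (orderComplex Q).Realization := by
  classical
  exact Realization.mk _ (joinFun e.emb o l y.1 s t) _
    (isChain_join e.bot_le e.le_top y.2.2.1.2) (joinFun_nonneg y.2.1 s t)
    (support_joinFun_subset _ _ _) (sum_joinFun (by rw [y.2.2.2, mul_one]) _)

/-- The parametrization of the edge `{o, l}`. -/
def edge (t : I) : (orderComplex Q).Realization := by
  classical
  exact Realization.mk _ (joinFun e.emb o l 0 (1 : I) t) _
    (isChain_join (ι := e.emb) e.bot_le e.le_top (s := ∅) (by simp))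
    (joinFun_nonneg (fun _ => le_rfl) 1 t)
    (support_joinFun_subset _ _ _) (sum_joinFun (by simp) _)

lemma join_one (y : (orderComplex P).Realization) (t : I) : e.join y 1 t = e.edge t :=
  Subtype.ext (joinFun_one _ _)

lemma join_left (y : (orderComplex P).Realization) (s t : I) : (e.join y s t).1 o = s * t :=
  joinFun_apply_left e.bot_notMem_range e.bot_ne_top _ _ _

lemma join_right (y : (orderComplex P).Realization) (s t : I) :
    (e.join y s t).1 l = s * (1 - t) :=
  joinFun_apply_right e.top_notMem_range e.bot_ne_top _ _ _

lemma join_apply (y : (orderComplex P).Realization) (s t : I) (x : P) :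
    (e.join y s t).1 (e.emb x) = (1 - s) * y.1 x :=
  joinFun_apply_embedding e.bot_notMem_range e.top_notMem_range _ _ _ _

lemma edge_left (t : I) : (e.edge t).1 o = t :=
  (joinFun_apply_left e.bot_notMem_range e.bot_ne_top _ _ _).trans (one_mul _)

lemma edge_right (t : I) : (e.edge t).1 l = 1 - t :=
  (joinFun_apply_right e.top_notMem_range e.bot_ne_top _ _ _).trans (one_mul _)

lemma edge_apply (t : I) (x : P) : (e.edge t).1 (e.emb x) = 0 :=
  (joinFun_apply_embedding e.bot_notMem_range e.top_notMem_range _ _ _ _).trans (by simp)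

lemma ext_realization {x y : (orderComplex Q).Realization} (ho : x.1 o = y.1 o) (hl : x.1 l = y.1 l)
    (h : ∀ p, x.1 (e.emb p) = y.1 (e.emb p)) : x = y := by
  refine Subtype.ext (Finsupp.ext fun q => ?_)
  by_cases hqo : q = o
  · rw [hqo, ho]
  by_cases hql : q = l
  · rw [hql, hl]
  obtain ⟨p, rfl⟩ := e.mem_range hqo hql
  exact h p

lemma continuous_join :
    Continuous fun p : (orderComplex P).Realization × I × I => e.join p.1 p.2.1 p.2.2 := by
  classical
  refine continuous_realization_prod fun s => continuous_of_support_subset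
    ⟨_, isChain_join (ι := e.emb) e.bot_le e.le_top s.2.2⟩ (fun p => ?_) fun q => ?_
  · exact (support_joinFun_subset _ _ _).trans (Finset.union_subset_union_right
      (Finset.map_subset_map.2 (support_faceMap_subset s p.1)))
  · by_cases hqo : q = o
    · subst hqo; simp only [join_left]; fun_prop
    by_cases hql : q = l
    · subst hql; simp only [join_right]; fun_prop
    obtain ⟨p, rfl⟩ := e.mem_range hqo hql
    simp only [join_apply]
    exact Continuous.mul (by fun_prop)
      (((continuous_coord p).comp (continuous_faceMap s)).comp continuous_fst)

lemma continuous_edge : Continuous e.edge := by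
  classical
  refine continuous_of_support_subset
    ⟨_, isChain_join (ι := e.emb) e.bot_le e.le_top (s := ∅) (by simp)⟩
    (fun p => support_joinFun_subset _ _ _) fun q => ?_
  by_cases hqo : q = o
  · subst hqo; simp only [edge_left]; fun_prop
  by_cases hql : q = l
  · subst hql; simp only [edge_right]; fun_prop
  obtain ⟨p, rfl⟩ := e.mem_range hqo hql
  simp only [edge_apply]
  fun_prop

lemma join_mem_endFaces {y : (orderComplex P).Realization} {s t : I}
    (h : s = 0 ∨ t = 0 ∨ t = 1) : e.join y s t ∈ endFaces o l := by
  rcases h with rfl | rfl | rfl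
  · left; rw [join_left]; simp
  · left; rw [join_left]; simp
  · right; rw [join_right]; simp

lemma edge_mem_endFaces {t : I} (h : t = 0 ∨ t = 1) : e.edge t ∈ endFaces o l := by
  rcases h with rfl | rfl
  · left; rw [edge_left]; simp
  · right; rw [edge_right]; simp

/-- The map from the suspension of `|ΔP|` that parametrizes `|ΔQ| / endFaces o l` at level `t`. -/
def toCollapseAux (x : Suspension (orderComplex P).Realization) (t : I) :
    Collapse (endFaces o l) :=
  Suspension.lift (fun y s => Collapse.mk _ (e.join y s t))
    (fun b => if b then Collapse.mk _ (e.edge t) else Collapse.base _)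
    (fun _ => Collapse.mk_eq_base (e.join_mem_endFaces (Or.inl rfl)))
    (fun y => by rw [join_one]; rfl) x

lemma toCollapseAux_end (x : Suspension (orderComplex P).Realization) {t : I} (h : t = 0 ∨ t = 1) :
    e.toCollapseAux x t = Collapse.base _ := by
  refine Suspension.ind (motive := fun x => e.toCollapseAux x t = Collapse.base _)
    (fun y s => ?_) ?_ x
  · change Collapse.mk _ (e.join y s t) = _
    exact Collapse.mk_eq_base (e.join_mem_endFaces (Or.inr h))
  · rintro (_ | _)
    · rfl
    · change Collapse.mk _ (e.edge t) = _
      exact Collapse.mk_eq_base (e.edge_mem_endFaces h)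

/-- The map from the double suspension of `|ΔP|` onto `|ΔQ| / endFaces o l`. -/
def toCollapse : Suspension (Suspension (orderComplex P).Realization) → Collapse (endFaces o l) :=
  Suspension.lift e.toCollapseAux (fun _ => Collapse.base _)
    (fun x => e.toCollapseAux_end x (Or.inl rfl)) (fun x => e.toCollapseAux_end x (Or.inr rfl))

lemma endFaces_nonempty : (endFaces o l).Nonempty := ⟨_, e.edge_mem_endFaces (Or.inl rfl)⟩

lemma continuous_toCollapse : Continuous e.toCollapse := by
  have hmk := (Collapse.isQuotientMap_mk e.endFaces_nonempty).continuous
  refine Suspension.continuous_of (Suspension.continuous_prod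
    (f := fun p => e.toCollapseAux p.1 p.2) ?_ ?_)
  · have hc : Continuous fun p : ((orderComplex P).Realization × I) × I => (p.1.1, p.1.2, p.2) := by
      fun_prop
    have hj := hmk.comp (e.continuous_join.comp hc)
    exact hj
  · rintro (_ | _)
    · exact continuous_const
    · exact hmk.comp e.continuous_edge

lemma join_notMem_endFaces {y : (orderComplex P).Realization} {s t : I} (hs : 0 < (s : ℝ))
    (ht : 0 < (t : ℝ)) (ht1 : (t : ℝ) < 1) : e.join y s t ∉ endFaces o l := by
  rintro (h | h)
  · rw [join_left] at h
    exact (mul_pos hs ht).ne' h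
  · rw [join_right] at h
    exact (mul_pos hs (sub_pos.2 ht1)).ne' h

lemma edge_notMem_endFaces {t : I} (ht : 0 < (t : ℝ)) (ht1 : (t : ℝ) < 1) :
    e.edge t ∉ endFaces o l := by
  rintro (h | h)
  · rw [edge_left] at h
    exact ht.ne' h
  · rw [edge_right] at h
    exact (sub_pos.2 ht1).ne' h

/-- Outside the arc the image avoids the end faces, hence differs from the base point and determines
a point of `|ΔQ|`. There the two end coordinates sum to `s`, which separates the edge (`s = 1`) from
the remaining points (`s < 1`). -/
lemma toCollapse_fibers (x y : Suspension (Suspension (orderComplex P).Realization))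
    (h : e.toCollapse x = e.toCollapse y) :
    x = y ∨ (x ∈ Set.range (Suspension.mk (Suspension.pole false)) ∧
      y ∈ Set.range (Suspension.mk (Suspension.pole false))) := by
  have hc {z : (orderComplex Q).Realization} (hz : z ∉ endFaces o l) :
      Collapse.mk (endFaces o l) z ≠ Collapse.base _ := fun h =>
    collapseCoord_mk_ne_zero hz (congrArg (collapseCoord o l) h)
  have hinj {z z' : (orderComplex Q).Realization} (hz : z ∉ endFaces o l)
      (h : Collapse.mk (endFaces o l) z = Collapse.mk _ z') : z = z' :=
    eq_of_collapseCoord_eq hz (congrArg (collapseCoord o l) h)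
  rcases Suspension.double_cases x with hx | ⟨t, ht, ht1, rfl⟩ | ⟨u, s, t, hs, hs1, ht, ht1, rfl⟩
  · right
    refine ⟨hx, ?_⟩
    obtain ⟨r, rfl⟩ := hx
    rcases Suspension.double_cases y with hy | ⟨t, ht, ht1, rfl⟩ | ⟨u, s, t, hs, hs1, ht, ht1, rfl⟩
    · exact hy
    · exact absurd h.symm (hc (e.edge_notMem_endFaces ht ht1))
    · exact absurd h.symm (hc (e.join_notMem_endFaces hs ht ht1))
  · left
    have hz := e.edge_notMem_endFaces ht ht1
    rcases Suspension.double_cases y with ⟨r, rfl⟩ | ⟨t', ht', ht1', rfl⟩ |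
      ⟨u', s', t', hs', hs1', ht', ht1', rfl⟩
    · exact absurd h (hc hz)
    · have h1 := congrArg (fun z => z.1 o) (hinj hz h)
      simp only [edge_left] at h1
      rw [Subtype.ext h1]
    · have h1 := congrArg (fun z => z.1 o) (hinj hz h)
      have h2 := congrArg (fun z => z.1 l) (hinj hz h)
      simp only [edge_left, edge_right, join_left, join_right] at h1 h2
      linarith
  · left
    have hz := e.join_notMem_endFaces (y := u) hs ht ht1
    rcases Suspension.double_cases y with ⟨r, rfl⟩ | ⟨t', ht', ht1', rfl⟩ |
      ⟨u', s', t', hs', hs1', ht', ht1', rfl⟩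
    · exact absurd h (hc hz)
    · have h1 := congrArg (fun z => z.1 o) (hinj hz h)
      have h2 := congrArg (fun z => z.1 l) (hinj hz h)
      simp only [edge_left, edge_right, join_left, join_right] at h1 h2
      linarith
    · have h1 := congrArg (fun z => z.1 o) (hinj hz h)
      have h2 := congrArg (fun z => z.1 l) (hinj hz h)
      simp only [join_left, join_right] at h1 h2
      -- The end coordinates are `s * t` and `s * (1 - t)`. Their sum gives `s`, then the first one
      -- gives `t`, and the other coordinates divided by `1 - s` give the point of `|ΔP|`.
      obtain rfl : s = s' := Subtype.ext (by linarith)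
      obtain rfl : t = t' := Subtype.ext (mul_left_cancel₀ hs.ne' h1)
      obtain rfl : u = u' := Subtype.ext (Finsupp.ext fun p => by
        have h3 := congrArg (fun z => z.1 (e.emb p)) (hinj hz h)
        simp only [join_apply] at h3
        exact mul_left_cancel₀ (sub_pos.2 hs1).ne' h3)
      rfl

/-- The points of `|ΔQ|` not on the edge and not in the end faces are in the image of the join
parametrization. -/
lemma exists_join_eq (x : (orderComplex Q).Realization) (hx : x ∉ endFaces o l) :
    (∃ t, x = e.edge t) ∨ ∃ y s t, x = e.join y s t ∧
      ∀ p ∈ y.1.support, e.emb p ∈ x.1.support := by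
  classical
  have ho : 0 < x.1 o := lt_of_le_of_ne (x.2.1 o) fun h => hx (Or.inl h.symm)
  have hl : 0 < x.1 l := lt_of_le_of_ne (x.2.1 l) fun h => hx (Or.inr h.symm)
  -- The join coordinates of `x` are `s`, the ratio `x o / s`, and the restriction `f` of `x` to `P`
  -- divided by `1 - s`. If `s = 1`, there is nothing to normalize and `x` lies on the edge.
  set s := x.1 o + x.1 l with hs
  have hs0 : 0 < s := add_pos ho hl
  have ht : x.1 o / s ∈ I := ⟨by positivity, by rw [div_le_one hs0]; linarith⟩
  set f : P →₀ ℝ := x.1.comapDomain e.emb e.emb.injective.injOn with hf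
  have hfx : ∀ p, f p = x.1 (e.emb p) := fun p => Finsupp.comapDomain_apply ..
  have hdec : x.1 = f.embDomain e.emb.toEmbedding +
      (Finsupp.single o (x.1 o) + Finsupp.single l (x.1 l)) := by
    ext q
    by_cases hqo : q = o
    · subst hqo
      simp [Finsupp.embDomain_of_notMem_range e.emb.toEmbedding f _
        e.bot_notMem_range, e.bot_ne_top]
    by_cases hql : q = l
    · subst hql
      simp [Finsupp.embDomain_of_notMem_range e.emb.toEmbedding f _
        e.top_notMem_range, e.bot_ne_top.symm]
    obtain ⟨p, rfl⟩ := e.mem_range hqo hql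
    have h3 := Finsupp.embDomain_apply_self e.emb.toEmbedding f p
    simp only [RelEmbedding.coe_toEmbedding] at h3
    simp [h3, hfx, Ne.symm hqo, Ne.symm hql]
  have hsum : (f.sum fun _ r => r) = 1 - s := by
    have h1 := x.2.2.2
    rw [Finsupp.sum_eq_linearCombination_one, hdec] at h1
    simp only [map_add, Finsupp.linearCombination_embDomain, Finsupp.linearCombination_single,
      smul_eq_mul, mul_one] at h1
    rw [Finsupp.sum_eq_linearCombination_one]
    change Finsupp.linearCombination ℝ (fun _ => (1 : ℝ)) f + _ = 1 at h1
    linarith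
  have hf0 : ∀ p, 0 ≤ f p := fun p => hfx p ▸ x.2.1 _
  have hs1 : s ≤ 1 := by
    have : 0 ≤ f.sum fun _ r => r := Finset.sum_nonneg fun p _ => hf0 p
    linarith
  rcases hs1.eq_or_lt with h1 | h1
  · left
    have hfz : ∀ p, f p = 0 := by
      intro p
      by_contra hp
      rw [h1, sub_self, Finsupp.sum, Finset.sum_eq_zero_iff_of_nonneg fun p _ => hf0 p] at hsum
      exact hp (hsum p (Finsupp.mem_support_iff.2 hp))
    refine ⟨⟨x.1 o, by rw [h1, div_one] at ht; exact ht⟩, e.ext_realization ?_ ?_ fun p => ?_⟩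
    · rw [edge_left]
    · rw [edge_right]
      change x.1 l = 1 - x.1 o
      linarith
    · rw [edge_apply, ← hfx, hfz]
  · right
    have h1' : 0 < 1 - s := sub_pos.2 h1
    have hg1 : (((1 - s)⁻¹ • f).sum fun _ r => r) = 1 := by
      rw [Finsupp.sum_eq_linearCombination_one, map_smul, ← Finsupp.sum_eq_linearCombination_one,
        hsum, smul_eq_mul, inv_mul_cancel₀ h1'.ne']
    have hsupp : ∀ p ∈ ((1 - s)⁻¹ • f).support, e.emb p ∈ x.1.support := by
      intro p hp
      rw [Finsupp.mem_support_iff, ← hfx]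
      exact Finsupp.mem_support_iff.1 (Finsupp.support_smul hp)
    have hne : ((1 - s)⁻¹ • f).support.Nonempty := by
      by_contra h
      rw [Finset.not_nonempty_iff_eq_empty, Finsupp.support_eq_empty] at h
      rw [h, Finsupp.sum_zero_index] at hg1
      exact zero_ne_one hg1
    have hchain : IsChain (· ≤ ·) (((1 - s)⁻¹ • f).support : Set P) := by
      intro p hp p' hp' _
      rcases x.2.2.1.2.total (hsupp p hp) (hsupp p' hp') with h | h
      · exact Or.inl (e.emb.le_iff_le.1 h)
      · exact Or.inr (e.emb.le_iff_le.1 h)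
    obtain ⟨y, hy⟩ : ∃ y : (orderComplex P).Realization, y.1 = (1 - s)⁻¹ • f :=
      ⟨⟨_, fun p => mul_nonneg (inv_nonneg.2 h1'.le) (hf0 p), ⟨hne, hchain⟩, hg1⟩, rfl⟩
    obtain ⟨s', hs'⟩ : ∃ s' : I, (s' : ℝ) = s := ⟨⟨s, hs0.le, hs1⟩, rfl⟩
    obtain ⟨t, ht⟩ : ∃ t : I, (t : ℝ) = x.1 o / s := ⟨⟨_, ht⟩, rfl⟩
    refine ⟨y, s', t, e.ext_realization ?_ ?_ fun p => ?_, hy ▸ hsupp⟩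
    · rw [join_left, hs', ht, mul_div_cancel₀ _ hs0.ne']
    · rw [join_right, hs', ht, mul_sub, mul_div_cancel₀ _ hs0.ne']
      linarith
    · rw [join_apply, ← hfx, hs', hy]
      exact (mul_inv_cancel_left₀ h1'.ne' _).symm

/-- The weak topology on `|ΔP|` is not locally compact in general, but over one closed face of `ΔQ`
only the finitely many vertices of `P` in that face occur. The parameters over this face thus form a
compact set, together with the edge and one pole for the base point, and the target is Hausdorff. -/
lemma isQuotientMap_toCollapse : IsQuotientMap e.toCollapse := by
  classical
  refine isQuotientMap_of_isCompact (Collapse.isQuotientMap_mk e.endFaces_nonempty)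
    e.continuous_toCollapse fun s => ?_
  let s₀ : Finset P := s.1.preimage e.emb e.emb.injective.injOn
  have hc : Continuous fun p : ((orderComplex P).Realization × I) × I =>
      Suspension.mk (Suspension.mk p.1.1 p.1.2) p.2 :=
    Suspension.continuous_mk.comp
      ((Suspension.continuous_mk.comp continuous_fst).prodMk continuous_snd)
  have hc' : Continuous fun t : I =>
      Suspension.mk (Suspension.pole true : Suspension (orderComplex P).Realization) t :=
    Suspension.continuous_mk.comp (continuous_const.prodMk continuous_id)
  refine ⟨_, ((((isCompact_support_subset s₀).prod isCompact_univ).prod isCompact_univ).image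
    hc).union ((isCompact_range hc').union (isCompact_singleton (x := Suspension.pole false))),
    fun w => ?_⟩
  by_cases hw : (orderComplex Q).faceMap s w ∈ endFaces o l
  · exact ⟨_, Or.inr (Or.inr rfl), (Collapse.mk_eq_base hw).symm⟩
  rcases e.exists_join_eq _ hw with ⟨t, ht⟩ | ⟨y, r, t, h, hy⟩
  · rw [ht]
    exact ⟨_, Or.inr (Or.inl ⟨t, rfl⟩), rfl⟩
  · refine ⟨_, Or.inl ⟨((y, r), t), ⟨⟨fun p hp => ?_, trivial⟩, trivial⟩, rfl⟩, ?_⟩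
    · exact Finset.mem_preimage.2 (support_faceMap_subset s w (hy p hp))
    · rw [h]
      rfl

/-- If `P` is the open part of a poset `Q` with bottom and top, then the quotient of `|ΔQ|` by the
chains that do not contain both ends is the double suspension of `|ΔP|`. -/
theorem nonempty_homotopyEquiv :
    Nonempty (Suspension (Suspension (orderComplex P).Realization) ≃ₕ
      Collapse (endFaces o l)) :=
  Suspension.nonempty_homotopyEquiv_of_isQuotientMap_pole e.isQuotientMap_toCollapse
    e.toCollapse_fibers fun _ _ => rfl

end OpenPart

/-! ### The causal interval of length `d(a, b)` -/

namespace CausalInterval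

variable {X : Type u} [MetricSpace X]

lemma le_def {ℓ : ℝ} {a b : X} {p q : CausalInterval ℓ a b} :
    p ≤ q ↔ dist p.point q.point ≤ q.time - p.time := Iff.rfl

lemma exists_list_of_isChain {ℓ : ℝ} {a b : X} (s : Finset (CausalInterval ℓ a b))
    (hs : IsChain (· ≤ ·) (s : Set (CausalInterval ℓ a b))) :
    ∃ l : List (CausalInterval ℓ a b), l.Pairwise (· < ·) ∧ ∀ p, p ∈ l ↔ p ∈ s := by
  classical
  revert hs
  refine Finset.induction_on_min_value CausalInterval.time s ?_ ?_
  · exact fun _ => ⟨[], List.Pairwise.nil, by simp⟩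
  · intro p s hp hmin ih hs
    obtain ⟨l, hl, hls⟩ := ih (hs.mono (by simp))
    refine ⟨p :: l, List.pairwise_cons.2 ⟨fun q hq => ?_, hl⟩, by simp [hls]⟩
    rw [hls] at hq
    have hne : p ≠ q := fun h => hp (h ▸ hq)
    refine lt_of_le_of_ne ?_ hne
    rcases hs.total (x := p) (y := q) (by simp) (by simp [hq]) with h | h
    · exact h
    · have h1 := le_def.1 h
      have h2 := hmin q hq
      have h3 := dist_nonneg (x := q.point) (y := p.point)
      rw [le_def, dist_comm]
      linarith

/-- Each spatial step is at most the elapsed time, and elapsed times telescope up to the last event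
`q`. -/
lemma exists_seqLength_le {ℓ : ℝ} {a b : X} (l : List (CausalInterval ℓ a b)) :
    ∀ p : CausalInterval ℓ a b, (p :: l).Pairwise (· < ·) →
      ∃ q ∈ p :: l, seqLength ((p :: l).map CausalInterval.point) ≤ q.time - p.time := by
  induction l with
  | nil => exact fun p _ => ⟨p, by simp, by simp [seqLength]⟩
  | cons r l ih =>
    intro p hp
    obtain ⟨h1, h2⟩ := List.pairwise_cons.1 hp
    obtain ⟨q, hq, hle⟩ := ih r h2
    have h3 := le_def.1 (h1 r (by simp)).le
    refine ⟨q, List.mem_cons_of_mem _ hq, ?_⟩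
    simp only [List.map_cons, seqLength] at hle ⊢
    linarith

variable (a b : X)

/-- The least element of the causal interval. -/
def bot : CausalInterval (dist a b) a b := ⟨a, 0, ⟨le_rfl, dist_nonneg⟩, by simp, by simp⟩

/-- The greatest element of the causal interval. -/
def top : CausalInterval (dist a b) a b := ⟨b, dist a b, ⟨dist_nonneg, le_rfl⟩, by simp, by simp⟩

variable {a b}

/-- The bounds `d(a, x) ≤ t` and `d(x, b) ≤ d(a, b) - t` add up to the reverse of the triangle
inequality, so both are equalities. -/
lemma time_eq (p : CausalInterval (dist a b) a b) : p.time = dist a p.point := by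
  linarith [p.dist_left, p.dist_right, dist_triangle a p.point b]

lemma dist_add_dist (p : CausalInterval (dist a b) a b) :
    dist a p.point + dist p.point b = dist a b := by
  linarith [p.dist_left, p.dist_right, dist_triangle a p.point b]

lemma eq_bot_iff (p : CausalInterval (dist a b) a b) : p = bot a b ↔ p.point = a := by
  refine ⟨fun h => h ▸ rfl, fun h => CausalInterval.ext h ?_⟩
  rw [time_eq, h, dist_self]
  rfl

lemma eq_top_iff (p : CausalInterval (dist a b) a b) : p = top a b ↔ p.point = b := by
  refine ⟨fun h => h ▸ rfl, fun h => CausalInterval.ext h ?_⟩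
  rw [time_eq, h]
  rfl

lemma bot_le (p : CausalInterval (dist a b) a b) : bot a b ≤ p := by
  rw [le_def]
  simpa [bot] using p.dist_left

lemma le_top (p : CausalInterval (dist a b) a b) : p ≤ top a b := p.dist_right

lemma mem_shortComplex_iff (hab : a ≠ b) {s : Finset (CausalInterval (dist a b) a b)}
    (hs : s ∈ (orderComplex (CausalInterval (dist a b) a b)).faces) :
    s ∈ (shortComplex (dist a b) a b).faces ↔ bot a b ∉ s ∨ top a b ∉ s := by
  have hlt : bot a b < top a b :=
    lt_of_le_of_ne (bot_le _) fun h => hab (congrArg CausalInterval.point h)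
  constructor
  · rintro ⟨-, l, hl, hls, hlen⟩
    by_contra! h
    -- A chain through both ends is at least as long as its subsequence `a, b`, whose length is
    -- `d(a, b)`.
    have hsub : [bot a b, top a b].Sublist l := by
      refine List.sublist_of_subperm_of_pairwise (r := (· < ·)) ?_ ?_ hl
      · exact (List.subperm_of_subset (by simpa using hlt.ne) (by simp [hls, h.1, h.2]))
      · simpa using hlt
    have := (seqLength_sublist (hsub.map CausalInterval.point)).1
    simp only [List.map_cons, List.map_nil, seqLength, bot, top] at this
    linarith
  · intro h
    obtain ⟨l, hl, hls⟩ := exists_list_of_isChain s hs.2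
    refine ⟨hs.1, l, hl, hls, ?_⟩
    cases l with
    | nil => simpa [seqLength] using hab
    | cons p l =>
      -- The length is at most `q.time - p.time`. If the bottom is missing, then `p.time > 0`; if
      -- the top is missing, then `q.time < d(a, b)`.
      obtain ⟨q, hq, hle⟩ := exists_seqLength_le l p hl
      refine hle.trans_lt ?_
      have hp : p ∈ s := (hls p).1 (by simp)
      have hq' : q ∈ s := (hls q).1 hq
      rcases h with h | h
      · have hne : p.point ≠ a := fun h' => h ((eq_bot_iff p).2 h' ▸ hp)
        have h0 := dist_pos.2 hne.symm
        linarith [q.time_mem.2, time_eq p]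
      · have hne : q.point ≠ b := fun h' => h ((eq_top_iff q).2 h' ▸ hq')
        have h0 := dist_pos.2 hne
        linarith [p.time_mem.1, time_eq q, dist_add_dist q]

lemma realizationOf_shortComplex (hab : a ≠ b) :
    (orderComplex (CausalInterval (dist a b) a b)).realizationOf (shortComplex (dist a b) a b) =
      endFaces (bot a b) (top a b) := by
  ext x
  change x.1.support ∈ (shortComplex (dist a b) a b).faces ↔ _
  rw [mem_shortComplex_iff hab x.2.2.1, Finsupp.notMem_support_iff, Finsupp.notMem_support_iff]
  rfl

/-- The open metric interval is the open part of the causal interval. -/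
def openPart {P : Type v} [PartialOrder P] (hab : a ≠ b) (e : P ≃o OpenMetricInterval a b) :
    OpenPart P (bot a b) (top a b) where
  emb := OrderEmbedding.ofMapLEIff
    (fun p => ⟨(e p).1.1, dist a (e p).1.1, ⟨dist_nonneg, by
      linarith [(e p).1.2, dist_nonneg (x := (e p).1.1) (y := b)]⟩, le_rfl, by
      linarith [(e p).1.2]⟩) fun p q => by
    rw [← e.le_iff_le]
    change dist (e p).1.1 (e q).1.1 ≤ dist a (e q).1.1 - dist a (e p).1.1 ↔
      dist a (e p).1.1 + dist (e p).1.1 (e q).1.1 + dist (e q).1.1 b = dist a b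
    -- Given that `q` lies in the interval, the interval relation says `d(p, q) = d(a, q) - d(a,
    -- p)`, and the triangle inequality provides one half of this equation.
    have h1 := (e q).1.2
    have h2 := dist_triangle a (e p).1.1 (e q).1.1
    constructor <;> intro h <;> linarith
  bot_le := bot_le
  le_top := le_top
  bot_ne_top h := hab (congrArg CausalInterval.point h)
  range_eq := by
    ext p
    rw [Set.mem_ofPred_eq, Ne, Ne, eq_bot_iff, eq_top_iff]
    constructor
    · rintro ⟨q, rfl⟩
      exact (e q).2
    · intro h
      refine ⟨e.symm ⟨⟨p.point, dist_add_dist p⟩, h⟩, ?_⟩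
      ext
      · simp
      · simp [time_eq p]

end CausalInterval

/-- The magnitude homotopy type of length `d(a, b)` is the double suspension of the order complex
of the open interval. -/
theorem nonempty_magnitudeHomotopyType_equiv {X : Type u} [MetricSpace X] {a b : X} (hab : a ≠ b)
    {P : Type v} [PartialOrder P] (e : P ≃o OpenMetricInterval a b) :
    Nonempty (Suspension (Suspension (orderComplex P).Realization) ≃ₕ
      MagnitudeHomotopyType (dist a b) a b) := by
  have h := (CausalInterval.openPart hab e).nonempty_homotopyEquiv
  rwa [← CausalInterval.realizationOf_shortComplex hab] at h

/-! ### Barycentric subdivision -/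

namespace PreAbstractSimplicialComplex

variable {V : Type u} {Z : PreAbstractSimplicialComplex V}

/-- The barycenter of a simplex. -/
def barycenter (s : Finset V) : V →₀ ℝ :=
  Finsupp.indicator s fun _ _ => (s.card : ℝ)⁻¹

lemma barycenter_apply_of_mem {s : Finset V} {v : V} (hv : v ∈ s) :
    barycenter s v = (s.card : ℝ)⁻¹ := Finsupp.indicator_of_mem hv _

lemma barycenter_apply_of_notMem {s : Finset V} {v : V} (hv : v ∉ s) :
    barycenter s v = 0 := Finsupp.indicator_of_notMem hv _

lemma barycenter_nonneg (s : Finset V) (v : V) : 0 ≤ barycenter s v := by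
  by_cases hv : v ∈ s
  · rw [barycenter_apply_of_mem hv]; positivity
  · rw [barycenter_apply_of_notMem hv]

lemma sum_barycenter {s : Finset V} (hs : s.Nonempty) :
    Finsupp.linearCombination ℝ (fun _ => (1 : ℝ)) (barycenter s) = 1 := by
  rw [← Finsupp.sum_eq_linearCombination_one, Finsupp.sum_of_support_subset (s := s) _
    (show (barycenter s).support ⊆ s from Finsupp.support_indicator_subset ..) _ (fun _ _ => rfl),
    Finset.sum_congr rfl fun v hv => barycenter_apply_of_mem hv]
  have : (s.card : ℝ) ≠ 0 := by simpa using hs.ne_empty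
  simp [this]

/-- The linear extension of the map that takes a simplex to its barycenter. -/
def barySum : (Z.faces →₀ ℝ) →ₗ[ℝ] V →₀ ℝ :=
  Finsupp.linearCombination ℝ fun s : Z.faces => barycenter s.1

lemma barySum_apply (w : Z.faces →₀ ℝ) (v : V) :
    barySum w v = ∑ s ∈ w.support, w s * barycenter s.1 v := by
  simp [barySum, Finsupp.linearCombination_apply, Finsupp.sum]

lemma sum_barySum (w : Z.faces →₀ ℝ) :
    ((barySum w).sum fun _ r => r) = w.sum fun _ r => r := by
  have hlin : (Finsupp.linearCombination ℝ (fun _ : V => (1 : ℝ))) ∘ₗ barySum =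
      Finsupp.linearCombination ℝ (fun _ : Z.faces => (1 : ℝ)) := by
    ext s
    simp [barySum, sum_barycenter (Z.isRelLowerSet_faces s.2).1]
  rw [Finsupp.sum_eq_linearCombination_one, Finsupp.sum_eq_linearCombination_one, ← hlin,
    LinearMap.comp_apply]

lemma barySum_nonneg {w : Z.faces →₀ ℝ} (hw : ∀ s, 0 ≤ w s) (v : V) : 0 ≤ barySum w v := by
  rw [barySum_apply]
  exact Finset.sum_nonneg fun s _ => mul_nonneg (hw s) (barycenter_nonneg _ _)

lemma barySum_ne_zero_iff {w : Z.faces →₀ ℝ} (hw : ∀ s, 0 ≤ w s) {v : V} :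
    barySum w v ≠ 0 ↔ ∃ s ∈ w.support, v ∈ s.1 := by
  rw [barySum_apply, Ne, Finset.sum_eq_zero_iff_of_nonneg fun s _ =>
    mul_nonneg (hw s) (barycenter_nonneg _ _)]
  push Not
  refine exists_congr fun s => and_congr_right fun hs => ?_
  rw [mul_ne_zero_iff, and_iff_right (Finsupp.mem_support_iff.1 hs)]
  by_cases hv : v ∈ s.1
  · have : (s.1.card : ℝ) ≠ 0 := by simpa using Finset.ne_empty_of_mem hv
    simp [barycenter_apply_of_mem hv, hv, this]
  · simp [barycenter_apply_of_notMem hv, hv]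

lemma exists_max_of_isChain {w : Z.faces →₀ ℝ} (hc : IsChain (· ≤ ·) (w.support : Set Z.faces))
    (hw : w ≠ 0) : ∃ m ∈ w.support, ∀ s ∈ w.support, s ≤ m := by
  obtain ⟨m, hm⟩ := w.support.exists_maximal (Finsupp.support_nonempty_iff.2 hw)
  refine ⟨m, hm.1, fun s hs => ?_⟩
  rcases hc.total hs hm.1 with h | h
  · exact h
  · exact hm.2 hs h

/-- The support of the image is the largest simplex of the chain. -/
lemma support_barySum {w : Z.faces →₀ ℝ} (hw : ∀ s, 0 ≤ w s) {m : Z.faces} (hm : m ∈ w.support)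
    (hmax : ∀ s ∈ w.support, s ≤ m) : (barySum w).support = m.1 := by
  ext v
  rw [Finsupp.mem_support_iff, barySum_ne_zero_iff hw]
  exact ⟨fun ⟨s, hs, hv⟩ => hmax s hs hv, fun hv => ⟨m, hm, hv⟩⟩

lemma exists_support_barySum {w : Z.faces →₀ ℝ} (hw : ∀ s, 0 ≤ w s)
    (hc : IsChain (· ≤ ·) (w.support : Set Z.faces)) (h0 : w ≠ 0) :
    ∃ m ∈ w.support, (∀ s ∈ w.support, s ≤ m) ∧ (barySum w).support = m.1 := by
  obtain ⟨m, hm, hmax⟩ := exists_max_of_isChain hc h0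
  exact ⟨m, hm, hmax, support_barySum hw hm hmax⟩

/-- The weight of the largest simplex of a chain is determined by the smallest coordinate. -/
lemma barySum_le {w w' : Z.faces →₀ ℝ} (hw' : ∀ s, 0 ≤ w' s)
    (hc : IsChain (· ≤ ·) (w.support : Set Z.faces))
    {m : Z.faces} (hm : m ∈ w.support) (hmax : ∀ s ∈ w.support, s ≤ m) (hm' : m ∈ w'.support)
    (h : barySum w = barySum w') : w' m ≤ w m := by
  classical
  have hcard : (0 : ℝ) < (m.1.card : ℝ)⁻¹ := by
    have := Finset.card_pos.2 (Z.isRelLowerSet_faces m.2).1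
    positivity
  have hc' : IsChain (· ≤ ·) ((w.erase m).support : Set Z.faces) :=
    hc.mono (by simp [Finsupp.support_erase])
  -- A vertex of `m` outside the next largest simplex of the chain lies in no other simplex of the
  -- chain. At this vertex only `m` contributes to `barySum w`, whereas `barySum w'` is at least the
  -- contribution of `m`.
  obtain ⟨v, hv, hvs⟩ : ∃ v ∈ m.1, ∀ s ∈ w.support, s ≠ m → v ∉ s.1 := by
    by_cases h0 : w.erase m = 0
    · obtain ⟨v, hv⟩ := (Z.isRelLowerSet_faces m.2).1
      refine ⟨v, hv, fun s hs hsm => absurd ?_ (Finsupp.mem_support_iff.1 hs)⟩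
      rw [← Finsupp.erase_ne hsm, h0, Finsupp.zero_apply]
    · obtain ⟨k, hk, hkmax⟩ := exists_max_of_isChain hc' h0
      rw [Finsupp.support_erase, Finset.mem_erase] at hk
      have hlt : k < m := lt_of_le_of_ne (hmax k hk.2) hk.1
      obtain ⟨v, hv, hvk⟩ := Finset.exists_of_ssubset hlt
      exact ⟨v, hv, fun s hs hsm hvs => hvk
        (hkmax s (by rw [Finsupp.support_erase]; exact Finset.mem_erase.2 ⟨hsm, hs⟩) hvs)⟩
  have h1 : barySum w v = w m * (m.1.card : ℝ)⁻¹ := by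
    rw [barySum_apply, Finset.sum_eq_single m, barycenter_apply_of_mem hv]
    · intro s hs hsm
      rw [barycenter_apply_of_notMem (hvs s hs hsm), mul_zero]
    · exact fun h => absurd hm h
  have h2 : w' m * (m.1.card : ℝ)⁻¹ ≤ barySum w' v := by
    rw [barySum_apply, ← barycenter_apply_of_mem hv]
    exact Finset.single_le_sum (f := fun s => w' s * barycenter s.1 v)
      (fun s _ => mul_nonneg (hw' s) (barycenter_nonneg _ _)) hm'
  rw [← h, h1] at h2
  exact le_of_mul_le_mul_right h2 hcard

/-- Both chains have the support of the common image as largest simplex, and its weights agree by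
`barySum_le` in both directions. Removing it from both reduces the number of simplices. -/
lemma barySum_injective (n : ℕ) : ∀ {w w' : Z.faces →₀ ℝ}, w.support.card = n →
    (∀ s, 0 ≤ w s) → (∀ s, 0 ≤ w' s) → IsChain (· ≤ ·) (w.support : Set Z.faces) →
    IsChain (· ≤ ·) (w'.support : Set Z.faces) → barySum w = barySum w' → w = w' := by
  classical
  induction n with
  | zero =>
    intro w w' hn hw hw' hc hc' h
    obtain rfl : w = 0 := by simpa using hn
    by_contra hne
    obtain ⟨m, -, -, hm⟩ := exists_support_barySum hw' hc' (Ne.symm hne)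
    rw [← h, map_zero, Finsupp.support_zero] at hm
    exact (Z.isRelLowerSet_faces m.2).1.ne_empty hm.symm
  | succ n ih =>
    intro w w' hn hw hw' hc hc' h
    have h0 : w ≠ 0 := by rintro rfl; simp at hn
    obtain ⟨m, hm, hmax, hsupp⟩ := exists_support_barySum hw hc h0
    have h0' : w' ≠ 0 := by
      rintro rfl
      rw [h, map_zero, Finsupp.support_zero] at hsupp
      exact (Z.isRelLowerSet_faces m.2).1.ne_empty hsupp.symm
    obtain ⟨m', hm', hmax', hsupp'⟩ := exists_support_barySum hw' hc' h0'
    obtain rfl : m = m' := Subtype.ext (by rw [← hsupp, ← hsupp', h])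
    have heq : w m = w' m := le_antisymm (barySum_le hw hc' hm' hmax' hm h.symm)
      (barySum_le hw' hc hm hmax hm' h)
    have herase : ∀ {u : Z.faces →₀ ℝ}, (∀ s, 0 ≤ u s) → ∀ s, 0 ≤ u.erase m s := by
      intro u hu s
      rw [Finsupp.erase_apply]
      split_ifs
      · exact le_rfl
      · exact hu s
    have hmono : ∀ {u : Z.faces →₀ ℝ}, ((u.erase m).support : Set Z.faces) ⊆ u.support := by
      intro u
      simp [Finsupp.support_erase]
    have key : w.erase m = w'.erase m := by
      refine ih ?_ (herase hw) (herase hw') (hc.mono hmono) (hc'.mono hmono) ?_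
      · rw [Finsupp.support_erase, Finset.card_erase_of_mem hm, hn, Nat.add_sub_cancel]
      · have e1 := congrArg barySum (Finsupp.single_add_erase m w)
        have e2 := congrArg barySum (Finsupp.single_add_erase m w')
        rw [map_add] at e1 e2
        rw [← h, ← e1, heq] at e2
        exact (add_left_cancel e2).symm
    rw [← Finsupp.single_add_erase m w, ← Finsupp.single_add_erase m w', key, heq]

/-- Subtracting the largest possible multiple of the barycenter of the support makes some coordinate
vanish. The rest has smaller support, so the simplices found for it lie below the one just used and
the chain condition is kept. -/
lemma barySum_surjective (n : ℕ) : ∀ {x : V →₀ ℝ}, x.support.card = n → (∀ v, 0 ≤ x v) →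
    (x.support.Nonempty → x.support ∈ Z.faces) → ∃ w : Z.faces →₀ ℝ, (∀ s, 0 ≤ w s) ∧
      IsChain (· ≤ ·) (w.support : Set Z.faces) ∧ barySum w = x := by
  classical
  induction n using Nat.strong_induction_on with
  | _ n ih =>
    intro x hn hx hs
    by_cases h0 : x = 0
    · exact ⟨0, by simp, by simp, by simp [h0]⟩
    have hne : x.support.Nonempty := Finsupp.support_nonempty_iff.2 h0
    obtain ⟨v₀, hv₀, hmin⟩ := x.support.exists_min_image x hne
    set m : Z.faces := ⟨x.support, hs hne⟩ with hm
    have hcard : (0 : ℝ) < x.support.card := by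
      exact_mod_cast Finset.card_pos.2 hne
    -- The barycenter has coordinates `1 / card`, so this multiple of it has coordinates equal to
    -- the minimum `x v₀`.
    set c : ℝ := x v₀ * x.support.card with hc
    have hc0 : 0 < c := mul_pos (lt_of_le_of_ne (hx v₀)
      (Ne.symm (Finsupp.mem_support_iff.1 hv₀))) hcard
    set x' : V →₀ ℝ := x - c • barycenter x.support with hx'
    have hx'mem : ∀ v ∈ x.support, x' v = x v - x v₀ := by
      intro v hv
      rw [hx', Finsupp.sub_apply, Finsupp.smul_apply, barycenter_apply_of_mem hv, smul_eq_mul, hc,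
        mul_assoc, mul_inv_cancel₀ hcard.ne', mul_one]
    have hx'not : ∀ v ∉ x.support, x' v = 0 := by
      intro v hv
      rw [hx', Finsupp.sub_apply, Finsupp.smul_apply, barycenter_apply_of_notMem hv,
        Finsupp.notMem_support_iff.1 hv, smul_zero, sub_zero]
    have hss : x'.support ⊆ x.support := fun v hv => by
      by_contra h
      exact Finsupp.mem_support_iff.1 hv (hx'not v h)
    have hlt : x'.support.card < n := hn ▸ Finset.card_lt_card ⟨hss, fun h => by
      have := Finsupp.mem_support_iff.1 (h hv₀)
      rw [hx'mem v₀ hv₀, sub_self] at this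
      exact this rfl⟩
    obtain ⟨w, hw, hwc, hwx⟩ := ih _ hlt (x := x') rfl (fun v => by
      by_cases hv : v ∈ x.support
      · rw [hx'mem v hv]
        exact sub_nonneg.2 (hmin v hv)
      · rw [hx'not v hv]) fun h => face_mono (hs hne) hss h
    have hle : ∀ s ∈ w.support, s ≤ m := fun s hs v hv => hss (by
      rw [← hwx, Finsupp.mem_support_iff, barySum_ne_zero_iff hw]
      exact ⟨s, hs, hv⟩)
    refine ⟨Finsupp.single m c + w, fun s => ?_, ?_, ?_⟩
    · rw [Finsupp.add_apply, Finsupp.single_apply]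
      exact add_nonneg (by split_ifs <;> simp [hc0.le]) (hw s)
    · refine (hwc.insert (a := m) fun s hs _ => Or.inr (hle s hs)).mono ?_
      intro s hs
      have := Finsupp.support_add hs
      rw [Finset.mem_union] at this
      rcases this with h | h
      · exact Or.inl (by simpa using Finsupp.support_single_subset h)
      · exact Or.inr h
    · rw [map_add, hwx, barySum, Finsupp.linearCombination_single, hx']
      exact add_sub_cancel _ _

/-- The canonical map from the barycentric subdivision to the complex. -/
def baryMap (w : (orderComplex Z.faces).Realization) : Z.Realization :=
  ⟨barySum w.1, barySum_nonneg w.2.1, by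
    have h0 : w.1 ≠ 0 := Finsupp.support_nonempty_iff.1 w.support_nonempty
    obtain ⟨m, -, -, h⟩ := exists_support_barySum w.2.1 w.2.2.1.2 h0
    exact h ▸ m.2, by
    rw [sum_barySum, w.2.2.2]⟩

lemma exists_support_baryMap (w : (orderComplex Z.faces).Realization) :
    ∃ m ∈ w.1.support, (∀ s ∈ w.1.support, s ≤ m) ∧ (baryMap w).1.support = m.1 :=
  exists_support_barySum w.2.1 w.2.2.1.2 (Finsupp.support_nonempty_iff.1 w.support_nonempty)

lemma baryMap_injective : Function.Injective (baryMap (Z := Z)) := fun w w' h =>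
  Subtype.ext (barySum_injective _ rfl w.2.1 w'.2.1 w.2.2.1.2 w'.2.2.1.2 (congrArg Subtype.val h))

lemma baryMap_surjective : Function.Surjective (baryMap (Z := Z)) := by
  intro x
  obtain ⟨w, hw, hc, hwx⟩ := barySum_surjective _ rfl x.2.1 fun _ => x.2.2.1
  refine ⟨⟨w, hw, ⟨?_, hc⟩, ?_⟩, Subtype.ext hwx⟩
  · rw [Finsupp.support_nonempty_iff]
    rintro rfl
    rw [map_zero] at hwx
    exact x.support_nonempty.ne_empty (by rw [← hwx, Finsupp.support_zero])
  · rw [← sum_barySum, hwx, x.2.2.2]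

lemma continuous_baryMap : Continuous (baryMap (Z := Z)) := by
  rw [continuous_realization_iff]
  intro c
  have hchain := c.2
  obtain ⟨m, hm⟩ := c.1.exists_maximal hchain.1
  -- The face of the subdivision spanned by the chain `c` is mapped into the single closed face `m`,
  -- where continuity can be checked on coordinates.
  have hmax : ∀ s ∈ c.1, s ≤ m := fun s hs => (hchain.2.total hs hm.1).elim id fun h => hm.2 hs h
  refine continuous_of_support_subset m (fun w => ?_) fun v => ?_
  · obtain ⟨k, hk, -, h⟩ := exists_support_baryMap ((orderComplex Z.faces).faceMap c w)
    exact h.le.trans (hmax k (support_faceMap_subset c w hk))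
  · have hsum : ∀ w, (baryMap ((orderComplex Z.faces).faceMap c w)).1 v =
        ∑ s ∈ c.1, ((orderComplex Z.faces).faceMap c w).1 s * barycenter s.1 v := by
      intro w
      refine (barySum_apply _ _).trans (Finset.sum_subset (support_faceMap_subset c w) ?_)
      intro s _ hs
      rw [Finsupp.notMem_support_iff.1 hs, zero_mul]
    refine (continuous_finsetSum _ fun s _ => ?_).congr fun w => (hsum w).symm
    exact ((continuous_coord s).comp (continuous_faceMap c)).mul continuous_const

/-- The barycentric subdivision of a complex is homeomorphic to the complex. -/
def baryHomeomorph : (orderComplex Z.faces).Realization ≃ₜ Z.Realization :=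
  IsHomeomorph.homeomorph baryMap (isHomeomorph_iff_isQuotientMap_injective.2 ⟨by
    classical
    -- The preimage of the closed face `s` is supported on the finitely many faces of `s`, hence
    -- covered by a compact set.
    refine isQuotientMap_of_isCompact .id continuous_baryMap fun s =>
      ⟨_, isCompact_support_subset ((s.1.powerset.subtype (· ∈ Z.faces))), fun x => ?_⟩
    obtain ⟨w, hw⟩ := baryMap_surjective (Z.faceMap s x)
    refine ⟨w, fun t ht => ?_, hw⟩
    obtain ⟨m, -, hmax, h⟩ := exists_support_baryMap w
    rw [Finset.mem_subtype, Finset.mem_powerset]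
    have h1 := support_faceMap_subset s x
    rw [← hw, h] at h1
    exact (hmax t ht).trans h1, baryMap_injective⟩)

end PreAbstractSimplicialComplex

/-! ### Weighted graphs ranked by a poset -/

namespace WeightedGraph

variable {V : Type u} [PartialOrder V]

/-- A weighted graph on a poset is ranked by `r` if its edges join comparable elements and have
the difference of the ranks as length, and comparable elements are joined by a walk whose length
is the difference of the ranks. -/
structure IsRanked (W : WeightedGraph V) (r : V → ℕ) : Prop where
  strictMono : StrictMono r
  comparable : ∀ {x y}, W.graph.Adj x y → x < y ∨ y < x
  length_eq : ∀ {x y} (h : W.graph.Adj x y), W.length ⟨s(x, y), h⟩ = |(r x : ℝ) - r y|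
  exists_walk : ∀ {x y}, x ≤ y → ∃ p : W.graph.Walk x y, W.walkLength p = (r y : ℝ) - r x

namespace IsRanked

variable {W : WeightedGraph V} {r : V → ℕ} (h : W.IsRanked r)

include h

lemma sub_le_walkLength {x y : V} (p : W.graph.Walk x y) : (r y : ℝ) - r x ≤ W.walkLength p := by
  induction p with
  | nil => simp [walkLength]
  | @cons x z y hxz p ih =>
    rw [walkLength, h.length_eq hxz]
    linarith [neg_le_abs ((r x : ℝ) - r z)]

/-- A walk that only ascends shows `x ≤ y`. A descending step adds to the length while lowering the
rank, so it costs twice the drop in excess of the rank difference, and drops of integer ranks are at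
least `1`. -/
lemma le_or_le_walkLength {x y : V} (p : W.graph.Walk x y) :
    x ≤ y ∨ (r y : ℝ) - r x + 1 ≤ W.walkLength p := by
  induction p with
  | nil => exact Or.inl le_rfl
  | @cons x z y hxz p ih =>
    rw [walkLength, h.length_eq hxz]
    rcases h.comparable hxz with hlt | hlt
    · rcases ih with hle | hle
      · exact Or.inl (hlt.le.trans hle)
      · right
        linarith [neg_le_abs ((r x : ℝ) - r z)]
    · right
      have h1 : (r z : ℝ) + 1 ≤ r x := by exact_mod_cast h.strictMono hlt
      linarith [le_abs_self ((r x : ℝ) - r z), h.sub_le_walkLength p]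

lemma pathDist_eq {x y : V} (hxy : x ≤ y) : W.pathDist x y = (r y : ℝ) - r x := by
  obtain ⟨p, hp⟩ := h.exists_walk hxy
  have : Nonempty (W.graph.Walk x y) := ⟨p⟩
  exact le_antisymm (hp ▸ W.pathDist_le p) (le_ciInf h.sub_le_walkLength)

/-- The excess in `le_or_le_walkLength` is uniform, so it survives the infimum over all walks. -/
lemma le_of_pathDist_le (hc : W.graph.Connected) {x y : V}
    (hxy : W.pathDist x y ≤ (r y : ℝ) - r x) : x ≤ y := by
  have : Nonempty (W.graph.Walk x y) := hc.preconnected x y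
  by_contra hn
  have : (r y : ℝ) - r x + 1 ≤ W.pathDist x y :=
    le_ciInf fun p => (h.le_or_le_walkLength p).resolve_left hn
  linarith

lemma connected {o : V} (ho : ∀ x, o ≤ x) : W.graph.Connected := by
  have hreach : ∀ x, W.graph.Reachable o x := fun x => ⟨(h.exists_walk (ho x)).choose⟩
  exact { preconnected := fun x y => (hreach x).symm.trans (hreach y), nonempty := ⟨o⟩ }

/-- The open interval between the bottom and the top of a ranked graph is the open part of the
poset. -/
theorem nonempty_orderIso (hc : W.graph.Connected) (hb : W.BoundedBelow) {P : Type v}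
    [PartialOrder P] {o l : V} (e : OpenPart P o l) :
    letI : MetricSpace V := W.metricSpace hc hb
    Nonempty (P ≃o OpenMetricInterval o l) := by
  let : MetricSpace V := W.metricSpace hc hb
  have hd : ∀ {x y : V}, x ≤ y → dist x y = (r y : ℝ) - r x := h.pathDist_eq
  have hmem : ∀ x : V, dist o x + dist x l = dist o l := fun x => by
    rw [hd (e.bot_le _), hd (e.le_top _), hd (e.bot_le _)]
    ring
  have hne : ∀ p, e.emb p ≠ o ∧ e.emb p ≠ l := fun p =>
    ⟨fun hp => e.bot_notMem_range ⟨p, hp⟩, fun hp => e.top_notMem_range ⟨p, hp⟩⟩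
  let f : P ↪o OpenMetricInterval o l :=
    OrderEmbedding.ofMapLEIff (fun p => ⟨⟨e.emb p, hmem _⟩, hne p⟩) fun p q => by
      rw [← e.emb.le_iff_le]
      change dist o (e.emb p) + dist (e.emb p) (e.emb q) + dist (e.emb q) l = dist o l ↔ _
      rw [hd (e.bot_le _), hd (e.le_top _), hd (e.bot_le _)]
      constructor
      · exact fun hpq => h.le_of_pathDist_le hc (le_of_eq (by
          change dist (e.emb p) (e.emb q) = _
          linarith))
      · intro hpq
        rw [hd hpq]
        ring
  refine ⟨RelIso.ofSurjective f fun x => ?_⟩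
  obtain ⟨p, hp⟩ := e.mem_range x.2.1 x.2.2
  exact ⟨p, Subtype.ext (Subtype.ext hp)⟩

/-- The magnitude homotopy type of a ranked graph between bottom and top. -/
theorem nonempty_magnitudeHomotopyType_equiv (hc : W.graph.Connected) (hb : W.BoundedBelow)
    {P : Type v} [PartialOrder P] {o l : V} (e : OpenPart P o l) :
    letI : MetricSpace V := W.metricSpace hc hb
    Nonempty (Suspension (Suspension (orderComplex P).Realization) ≃ₕ
      MagnitudeHomotopyType (dist o l) o l) := by
  let : MetricSpace V := W.metricSpace hc hb
  obtain ⟨f⟩ := h.nonempty_orderIso hc hb e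
  exact _root_.nonempty_magnitudeHomotopyType_equiv e.bot_ne_top f

end IsRanked

/-- The comparability graph of a poset, weighted by the differences of ranks. -/
def comparability {r : V → ℕ} (hr : StrictMono r) : WeightedGraph V where
  graph :=
    { Adj := fun x y => x < y ∨ y < x
      symm := ⟨fun _ _ => Or.symm⟩
      loopless := ⟨fun x hx => hx.elim (lt_irrefl x) (lt_irrefl x)⟩ }
  length e := Sym2.lift ⟨fun x y => |(r x : ℝ) - r y|, fun _ _ => abs_sub_comm _ _⟩ e.1
  length_pos := by
    rintro ⟨e, he⟩
    induction e using Sym2.ind with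
    | _ x y =>
      refine abs_pos.2 (sub_ne_zero.2 ?_)
      have : r x ≠ r y := he.elim (fun h => (hr h).ne) fun h => (hr h).ne'
      exact_mod_cast this

lemma isRanked_comparability {r : V → ℕ} (hr : StrictMono r) : (comparability hr).IsRanked r where
  strictMono := hr
  comparable h := h
  length_eq _ := rfl
  exists_walk {x y} hxy := by
    rcases hxy.eq_or_lt with rfl | hlt
    · exact ⟨.nil, by simp [walkLength]⟩
    · refine ⟨.cons (Or.inl hlt) .nil, ?_⟩
      have h1 : (r x : ℝ) < r y := by exact_mod_cast hr hlt
      change |(r x : ℝ) - r y| + 0 = _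
      rw [abs_of_neg (by linarith)]
      ring

lemma boundedBelow_comparability {r : V → ℕ} (hr : StrictMono r) :
    (comparability hr).BoundedBelow := by
  refine ⟨1, one_pos, ?_⟩
  rintro ⟨e, he⟩
  induction e using Sym2.ind with
  | _ x y =>
    change 1 ≤ |(r x : ℝ) - r y|
    rcases he with h | h
    · have h1 : (r x : ℝ) + 1 ≤ r y := by exact_mod_cast hr h
      exact le_abs.2 (Or.inr (by linarith))
    · have h1 : (r y : ℝ) + 1 ≤ r x := by exact_mod_cast hr h
      exact le_abs.2 (Or.inl (by linarith))

/-- The graph of the comparable pairs of elements whose ranks differ by `1`. -/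
def coverGraph (r : V → ℕ) : SimpleGraph V where
  Adj x y := x < y ∧ r y = r x + 1 ∨ y < x ∧ r x = r y + 1
  symm := ⟨fun _ _ => Or.symm⟩
  loopless := ⟨fun x hx => hx.elim (fun h => lt_irrefl x h.1) fun h => lt_irrefl x h.1⟩

/-- The condition `hstep` allows climbing from `x` to `y` one rank at a time, so a monotone walk of
unit edges exists by induction on the rank difference. -/
lemma isRanked_coverGraph {r : V → ℕ} (hr : StrictMono r)
    (hstep : ∀ x y, x < y → ∃ z, x < z ∧ z ≤ y ∧ r z = r x + 1) :
    (ofGraph (coverGraph r)).IsRanked r where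
  strictMono := hr
  comparable h := h.imp And.left And.left
  length_eq {x y} h := by
    change 1 = |(r x : ℝ) - r y|
    rcases h with h | h <;> rw [h.2] <;> simp
  exists_walk {x y} hxy := by
    obtain ⟨n, hn⟩ : ∃ n, r y = r x + n := Nat.exists_eq_add_of_le (hr.monotone hxy)
    induction n generalizing x with
    | zero =>
      rcases hxy.eq_or_lt with rfl | hlt
      · exact ⟨.nil, by simp [walkLength]⟩
      · exact absurd (hr hlt) (by omega)
    | succ n ih =>
      have hlt : x < y := lt_of_le_of_ne hxy (by rintro rfl; omega)
      obtain ⟨z, hxz, hzy, hz⟩ := hstep x y hlt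
      obtain ⟨p, hp⟩ := ih hzy (by omega)
      refine ⟨.cons (Or.inl ⟨hxz, hz⟩) p, ?_⟩
      change 1 + walkLength _ p = _
      rw [hp, hz]
      push_cast
      ring

end WeightedGraph

/-! ### Face lattices and the realization of complexes -/

/-- A poset is the open part of its extension by a bottom and a top. -/
def OpenPart.withBotTop (P : Type u) [PartialOrder P] :
    OpenPart P (⊥ : WithBot (WithTop P)) ⊤ where
  emb := OrderEmbedding.ofMapLEIff (fun p => ((p : WithTop P) : WithBot (WithTop P))) (by simp)
  bot_le _ := _root_.bot_le
  le_top _ := _root_.le_top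
  bot_ne_top := _root_.bot_ne_top
  range_eq := by
    ext x
    constructor
    · rintro ⟨p, rfl⟩
      exact ⟨WithBot.coe_ne_bot, fun h => WithTop.coe_ne_top (WithBot.coe_injective h)⟩
    · rintro ⟨h1, h2⟩
      induction x with
      | bot => exact absurd rfl h1
      | coe x =>
        induction x with
        | top => exact absurd rfl h2
        | coe x => exact ⟨x, rfl⟩

namespace PreAbstractSimplicialComplex

variable {V : Type u} (Z : PreAbstractSimplicialComplex V)

/-- The face poset of a complex, extended by a bottom and a top. -/
abbrev FaceLattice : Type u := WithBot (WithTop Z.faces)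

/-- The number of vertices, with the value `N + 1` at the top. -/
def faceRank (N : ℕ) : Z.FaceLattice → ℕ :=
  WithBot.recBotCoe 0 (WithTop.recTopCoe (N + 1) fun s => s.1.card)

variable {Z}

lemma strictMono_faceRank {N : ℕ} (hN : ∀ s ∈ Z.faces, s.card ≤ N) :
    StrictMono (Z.faceRank N) := by
  intro x y hxy
  induction x using WithBot.recBotCoe with
  | bot =>
    induction y using WithBot.recBotCoe with
    | bot => exact absurd hxy (lt_irrefl _)
    | coe y =>
      induction y with
      | top => exact Nat.succ_pos N
      | coe y => exact Finset.card_pos.2 (Z.isRelLowerSet_faces y.2).1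
  | coe x =>
    induction y using WithBot.recBotCoe with
    | bot => exact absurd hxy not_lt_bot
    | coe y =>
      rw [WithBot.coe_lt_coe] at hxy
      induction x with
      | top => exact absurd hxy not_top_lt
      | coe x =>
        induction y with
        | top => exact Nat.lt_succ_of_le (hN x.1 x.2)
        | coe y => exact Finset.card_lt_card (show x < y from WithTop.coe_lt_coe.1 hxy)

/-- A simplex with the most vertices is maximal, so by purity every maximal simplex has that many.
The last clause fixes `N` for the empty complex, so that the top has rank `1`, directly above the
bottom. -/
lemma exists_card_eq_of_isPure (hd : Z.IsFiniteDimensional) (hp : Z.IsPure) :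
    ∃ N, (∀ s ∈ Z.faces, s.card ≤ N) ∧ (∀ s, Maximal (· ∈ Z.faces) s → s.card = N) ∧
      (Z.faces = ∅ → N = 0) := by
  obtain ⟨n, hn⟩ := hd
  rcases Z.faces.eq_empty_or_nonempty with h | h
  · exact ⟨0, by simp [h], fun s hs => by simpa [h] using hs.1, fun _ => rfl⟩
  · have hb : BddAbove (Finset.card '' Z.faces) := ⟨n + 1, by rintro _ ⟨s, hs, rfl⟩; exact hn s hs⟩
    obtain ⟨m, hm, hcard⟩ := Nat.sSup_mem (h.image Finset.card) hb
    have hle : ∀ s ∈ Z.faces, s.card ≤ m.card := fun s hs =>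
      hcard ▸ le_csSup hb (Set.mem_image_of_mem _ hs)
    refine ⟨m.card, hle, fun s hs => hp s m hs ⟨hm, fun t ht hmt => ?_⟩,
      fun h' => absurd h' h.ne_empty⟩
    exact (Finset.eq_of_subset_of_card_le hmt (hle t ht)).ge

/-- One rank is gained by adding a single vertex. Only the step to the top is different: a maximal
simplex has `N` vertices, one less than the rank of the top. This is where purity enters. -/
lemma exists_faceRank_eq_succ {N : ℕ} (hmax : ∀ s, Maximal (· ∈ Z.faces) s → s.card = N)
    (hempty : Z.faces = ∅ → N = 0) (x y : Z.FaceLattice) (hxy : x < y) :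
    ∃ z, x < z ∧ z ≤ y ∧ Z.faceRank N z = Z.faceRank N x + 1 := by
  classical
  have hsingle : ∀ t : Z.faces, ∃ s : Z.faces, s ≤ t ∧ s.1.card = 1 := fun t => by
    obtain ⟨v, hv⟩ := (Z.isRelLowerSet_faces t.2).1
    exact ⟨⟨{v}, face_mono t.2 (by simpa using hv) (by simp)⟩,
      Finset.singleton_subset_iff.2 hv, Finset.card_singleton v⟩
  have hinsert : ∀ s t : Z.faces, s < t → ∃ r : Z.faces, s < r ∧ r ≤ t ∧
      r.1.card = s.1.card + 1 := fun s t hst => by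
    obtain ⟨v, hv, hvs⟩ := Finset.exists_of_ssubset hst
    exact ⟨⟨insert v s.1, face_mono t.2 (Finset.insert_subset hv hst.le) (by simp)⟩,
      Finset.ssubset_insert hvs, Finset.insert_subset hv hst.le, Finset.card_insert_of_notMem hvs⟩
  induction x using WithBot.recBotCoe with
  | bot =>
    induction y using WithBot.recBotCoe with
    | bot => exact absurd hxy (lt_irrefl _)
    | coe y =>
      induction y with
      | top =>
        rcases Z.faces.eq_empty_or_nonempty with h | ⟨t, ht⟩
        -- Without simplices the step goes directly from bottom to top, which needs `N + 1 = 1`.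
        · exact ⟨⊤, bot_lt_top, le_rfl, congrArg (· + 1) (hempty h)⟩
        · obtain ⟨s, -, hs⟩ := hsingle ⟨t, ht⟩
          exact ⟨((s : WithTop Z.faces) : Z.FaceLattice), WithBot.bot_lt_coe _, le_top, hs⟩
      | coe y =>
        obtain ⟨s, hsy, hs⟩ := hsingle y
        exact ⟨((s : WithTop Z.faces) : Z.FaceLattice), WithBot.bot_lt_coe _,
          WithBot.coe_le_coe.2 (WithTop.coe_le_coe.2 hsy), hs⟩
  | coe x =>
    induction y using WithBot.recBotCoe with
    | bot => exact absurd hxy not_lt_bot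
    | coe y =>
      rw [WithBot.coe_lt_coe] at hxy
      induction x with
      | top => exact absurd hxy not_top_lt
      | coe x =>
        induction y with
        | top =>
          by_cases hx : Maximal (· ∈ Z.faces) x.1
          · exact ⟨⊤, WithBot.coe_lt_coe.2 hxy, le_rfl, congrArg (· + 1) (hmax _ hx).symm⟩
          · obtain ⟨t, hxt, ht⟩ := exists_gt_of_not_maximal (P := (· ∈ Z.faces)) x.2 hx
            obtain ⟨s, hxs, -, hs⟩ := hinsert x ⟨t, ht⟩ hxt
            exact ⟨((s : WithTop Z.faces) : Z.FaceLattice),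
              WithBot.coe_lt_coe.2 (WithTop.coe_lt_coe.2 hxs), le_top, hs⟩
        | coe y =>
          obtain ⟨s, hxs, hsy, hs⟩ := hinsert x y (WithTop.coe_lt_coe.1 hxy)
          exact ⟨((s : WithTop Z.faces) : Z.FaceLattice),
            WithBot.coe_lt_coe.2 (WithTop.coe_lt_coe.2 hxs),
            WithBot.coe_le_coe.2 (WithTop.coe_le_coe.2 hsy), hs⟩

/-- A ranked graph on the face lattice realizes the double suspension of a complex as a magnitude
homotopy type. -/
theorem nonempty_equiv_magnitudeHomotopyType {W : WeightedGraph Z.FaceLattice}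
    {r : Z.FaceLattice → ℕ} (h : W.IsRanked r) (hc : W.graph.Connected) (hb : W.BoundedBelow) :
    letI : MetricSpace Z.FaceLattice := W.metricSpace hc hb
    Nonempty (Suspension (Suspension Z.Realization) ≃ₕ
      MagnitudeHomotopyType (dist (⊥ : Z.FaceLattice) ⊤) (⊥ : Z.FaceLattice) ⊤) := by
  let : MetricSpace Z.FaceLattice := W.metricSpace hc hb
  obtain ⟨e⟩ := h.nonempty_magnitudeHomotopyType_equiv hc hb (OpenPart.withBotTop Z.faces)
  exact ⟨(Suspension.homeomorph (Suspension.homeomorph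
    (baryHomeomorph (Z := Z)).symm)).toHomotopyEquiv.trans e⟩

end PreAbstractSimplicialComplex

theorem mainTheorem11 :
    (∀ (X : Type u) [MetricSpace X] (a b : X), a ≠ b →
      Nonempty (MagnitudeHomotopyType (dist a b) a b ≃ₕ
        Suspension (Suspension (orderComplex (OpenMetricInterval a b)).Realization))) ∧
    (∀ (V : Type v) (Z : PreAbstractSimplicialComplex V), Z.IsFiniteDimensional →
      ∃ (V' : Type v) (G : WeightedGraph V') (hc : G.graph.Connected) (hb : G.BoundedBelow)
        (a b : V') (ℓ : ℝ), 0 ≤ ℓ ∧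
        letI : MetricSpace V' := G.metricSpace hc hb
        Nonempty (Suspension (Suspension Z.Realization) ≃ₕ MagnitudeHomotopyType ℓ a b)) ∧
    (∀ (V : Type v) (Z : PreAbstractSimplicialComplex V), Z.IsFiniteDimensional → Z.IsPure →
      ∃ (V' : Type v) (G : SimpleGraph V') (hc : G.Connected) (a b : V') (ℓ : ℝ), 0 ≤ ℓ ∧
        (letI : MetricSpace V' := WeightedGraph.graphMetricSpace G hc
        Nonempty (Suspension (Suspension Z.Realization) ≃ₕ MagnitudeHomotopyType ℓ a b)) ∧
        (Z.faces.Finite → Finite V')) := by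
  refine ⟨fun X _ a b hab => ?_, fun V Z hd => ?_, fun V Z hd hp => ?_⟩
  · obtain ⟨e⟩ := nonempty_magnitudeHomotopyType_equiv hab (OrderIso.refl (OpenMetricInterval a b))
    exact ⟨e.symm⟩
  · obtain ⟨n, hn⟩ := hd
    -- Simplices have at most `n + 1` vertices, so the top receives rank `n + 2`.
    have hr := strictMono_faceRank hn
    have h := WeightedGraph.isRanked_comparability hr
    have hb := WeightedGraph.boundedBelow_comparability hr
    have hc := h.connected fun _ => bot_le
    let : MetricSpace Z.FaceLattice := (WeightedGraph.comparability hr).metricSpace hc hb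
    exact ⟨_, _, hc, hb, ⊥, ⊤, _, dist_nonneg, nonempty_equiv_magnitudeHomotopyType h hc hb⟩
  · obtain ⟨N, hN, hmax, hempty⟩ := exists_card_eq_of_isPure hd hp
    have h := WeightedGraph.isRanked_coverGraph (strictMono_faceRank hN)
      (exists_faceRank_eq_succ hmax hempty)
    have hc : (WeightedGraph.coverGraph (Z.faceRank N)).Connected := h.connected fun _ => bot_le
    let : MetricSpace Z.FaceLattice := WeightedGraph.graphMetricSpace _ hc
    refine ⟨Z.FaceLattice, _, hc, ⊥, ⊤, _, dist_nonneg,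
      nonempty_equiv_magnitudeHomotopyType h hc (WeightedGraph.ofGraph_boundedBelow _), fun hf => ?_⟩
    have := hf.to_subtype
    exact inferInstanceAs (Finite (Option (Option Z.faces)))
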